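/- **Pure types** are the closed expressions of the grammar $\tau ::= \mathbf 1 \mid \tau\times\tau \mid \tau\to\tau \mid \tau+\tau \mid \alpha \mid \mathrm{rec}\,\alpha.\tau$. A type $\tau$ is interpreted as a Scott domain $[\![\tau]\!]$: $[\![\mathbf 1]\!]=\{\bot<\top\}$; $[\![\sigma\times\tau]\!]$ is the Cartesian product; $[\![\sigma\to\tau]\!]$ is the set of Scott-continuous functions with the pointwise order; $[\![\sigma+\tau]\!]$ is the disjoint union of $[\![\sigma]\!]$ and $[\![\tau]\!]$ with a new least element added; and $[\![\mathrm{rec}\,\alpha.\tau]\!]$ is the colimit, in the category of embedding-projection pairs, of the chain $1\to F(1)\to F^2(1)\to\cdots$ for the functor $F=[\![\tau]\!](-)$, with its canonical isomorphism $\mathrm{unfold}:[\![\mathrm{rec}\,\alpha.\tau]\!]\to[\![\tau[\mathrm{rec}\,\alpha.\tau/\alpha]]\!]$. **Formulae.** Iteration terms are $t::=k\mid 0\mid t+1$, with $k$ an iteration variable. A fixpoint context $\Delta$ is a finite list $X_1:\sigma_1,\dots,X_n:\sigma_n$ of distinct fixpoint variables with pure types. For $s\in\{\pm,+,-\}$ (neutral,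 positive, negative; $-s$ fixes $\pm$ and exchanges $+$ and $-$), the sets $L^s(\Delta;\tau)$ are defined inductively as follows: - $\mathsf{True},\mathsf{False}\in L^s(\Delta;\tau)$, and $L^s(\Delta;\tau)$ is closed under $\wedge$ and $\vee$; - $\langle()\rangle\in L^s(\Delta;\mathbf 1)$; if $\varphi\in L^s(\Delta;\tau_i)$ then $\langle\pi_i\rangle\varphi\in L^s(\Delta;\tau_1\times\tau_2)$ and $\langle \mathrm{in}_i\rangle\varphi\in L^s(\Delta;\tau_1+\tau_2)$, for $i=1,2$; if $\varphi\in L^s(\Delta;\tau[\mathrm{rec}\,\alpha.\tau/\alpha])$ then $\langle\mathrm{fold}\rangle\varphi\in L^s(\Delta;\mathrm{rec}\,\alpha.\tau)$; - $X_i\in L^s(\Delta;\sigma_i)$; formulae may be weakened to larger fixpoint contexts; if $\varphi\in L^s(\Delta,X:\tau;\tau)$ then $(\mu^tX)\varphi,(\nu^tX)\varphi\in L^s(\Delta;\tau)$ for every iteration term $t$; - if $\varphi\in L^+(\Delta;\tau)$ and $k$ is positive in $\varphi$ then $(\exists k)\varphi\in L^+(\Delta;\tau)$; if $\varphi\in L^-(\Delta;\tau)$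 and $k$ is negative in $\varphi$ then $(\forall k)\varphi\in L^-(\Delta;\tau)$; - if $\psi\in L^{-s}(\,;\sigma)$ and $\varphi\in L^s(\,;\tau)$ (empty fixpoint contexts) then $(\psi\Rightarrow\varphi)\in L^s(\Delta;\sigma\to\tau)$. Here the relations "$k$ is positive in $\varphi$" and "$k$ is negative in $\varphi$" are the least ones such that: both hold if $k$ is not free in $\varphi$; both are preserved by $\wedge$, $\vee$ and the modalities $\langle\pi_i\rangle,\langle\mathrm{in}_i\rangle,\langle\mathrm{fold}\rangle$; $k$ is positive (negative) in $\psi\Rightarrow\varphi$ if it is negative (positive) in $\psi$ and positive (negative) in $\varphi$; positivity is preserved by $(\exists\ell)$ and $(\mu^tX)$, and also by $(\nu^tX)$ if $k$ does not occur in $t$; negativity is preserved by $(\forall\ell)$ and $(\nu^tX)$, and also by $(\mu^tX)$ if $k$ does not occur in $t$. **Semantics.** A valuation $\rho$ of $\Delta$ maps each $X_i$ to a subset of $[\![\sigma_i]\!]$ and each iteration variable to a natural number. The set $[\![\varphi]\!]\rho\subseteq[\![\tau]\!]$ is defined by: $\mathsf{True},\mathsf{False},\wedge,\vee$ are $[\![\tau]\!],\emptyset,\cap,\cup$;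 $[\![X_i]\!]\rho=\rho(X_i)$; $[\![\langle()\rangle]\!]\rho=\{\top\}$; $\langle\pi_i\rangle$ is the inverse image under the $i$-th projection, $\langle\mathrm{fold}\rangle$ the inverse image under $\mathrm{unfold}$, and $\langle\mathrm{in}_i\rangle$ the direct image under the $i$-th inclusion; $[\![\psi\Rightarrow\varphi]\!]\rho=\{f\mid\forall x\in[\![\psi]\!]\rho,\ f(x)\in[\![\varphi]\!]\rho\}$; $(\exists k)$ and $(\forall k)$ are the union and the intersection of $[\![\varphi]\!]\rho[m/k]$ over $m\in\mathbb N$; and $(\mu^tX)\varphi$, $(\nu^tX)\varphi$ are interpreted as the $[\![t]\!]\rho$-fold iterated substitutions of $\varphi$ for $X$ starting from $\mathsf{False}$, respectively $\mathsf{True}$, equivalently as the $[\![t]\!]\rho$-fold iterates of $S\mapsto[\![\varphi]\!]\rho[S/X]$ on $\emptyset$, respectively $[\![\tau]\!]$. **Proposition.** Let $\Delta$ be a fixpoint context, $\rho$ a valuation of $\Delta$, $(X:\sigma)\in\Delta$, $\tau$ a pure type, and consider, for a formula $\varphi$ of type $\tau$ over $\Delta$, the function $$\mathcal P([\![\sigma]\!])\to\mathcal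 P([\![\tau]\!]),\qquad S\mapsto[\![\varphi]\!]\rho[S/X].$$ 1. If $\varphi\in L^s(\Delta;\tau)$ for some $s\in\{\pm,+,-\}$, this function is monotone for inclusion. 2. If $\varphi\in L^+(\Delta;\tau)$, this function is Scott-continuous, i.e. it preserves unions of (nonempty) directed families. 3. If $\varphi\in L^-(\Delta;\tau)$, this function is Scott-cocontinuous, i.e. it preserves intersections of (nonempty) codirected families. -/

import Mathlib

open CategoryTheory

/-! ## Pure types (well-scoped de Bruijn syntax) -/

/-- `TyExpr n`: pure type expressions whose free type variables are among `n` given ones;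
`mu τ` is the recursive type binding the variable `0` of `τ`. -/
inductive TyExpr : ℕ → Type
  | unit {n : ℕ} : TyExpr n
  | prod {n : ℕ} (σ τ : TyExpr n) : TyExpr n
  | arrow {n : ℕ} (σ τ : TyExpr n) : TyExpr n
  | sum {n : ℕ} (σ τ : TyExpr n) : TyExpr n
  | var {n : ℕ} (i : Fin n) : TyExpr n
  | mu {n : ℕ} (τ : TyExpr (n + 1)) : TyExpr n

namespace TyExpr

/-- Renaming of type variables. -/
def ren : {n m : ℕ} → (Fin n → Fin m) → TyExpr n → TyExpr m
  | _, _, _, unit => unit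
  | _, _, r, prod σ τ => prod (σ.ren r) (τ.ren r)
  | _, _, r, arrow σ τ => arrow (σ.ren r) (τ.ren r)
  | _, _, r, sum σ τ => sum (σ.ren r) (τ.ren r)
  | _, _, r, var i => var (r i)
  | _, _, r, mu τ => mu (τ.ren (Fin.cases 0 fun i => (r i).succ))

/-- Lifting of a substitution under a binder. -/
def lift {n m : ℕ} (s : Fin n → TyExpr m) : Fin (n + 1) → TyExpr (m + 1) :=
  Fin.cases (var 0) fun i => (s i).ren Fin.succ

/-- Simultaneous capture-avoiding substitution. -/
def subst : {n m : ℕ} → (Fin n → TyExpr m) → TyExpr n → TyExpr m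
  | _, _, _, unit => unit
  | _, _, s, prod σ τ => prod (σ.subst s) (τ.subst s)
  | _, _, s, arrow σ τ => arrow (σ.subst s) (τ.subst s)
  | _, _, s, sum σ τ => sum (σ.subst s) (τ.subst s)
  | _, _, s, var i => s i
  | _, _, s, mu τ => mu (τ.subst (lift s))

/-- `τ.unroll` is `τ[mu τ / 0]`. -/
def unroll (τ : TyExpr 1) : TyExpr 0 := τ.subst fun _ => mu τ

end TyExpr

/-- Pure types are closed type expressions. -/
abbrev PureType : Type := TyExpr 0

/-! ## Cpo's and embedding-projection pairs -/

/-- A cpo: a partial order with a least element and suprema of all (nonempty) directed subsets.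

Scott domains (bounded-complete algebraic cpo's) form a full subcategory of the category of cpo's
and Scott-continuous functions, and this subcategory contains `1` and `{⊥ < ⊤}` and is closed under
products, function spaces, weak sums and colimits of `ω`-chains of embeddings, all computed as for
cpo's. The interpretation of pure types below uses only these operations, hence it takes values in
Scott domains and is the usual one. -/
structure Cpo : Type 1 where
  carrier : Type
  [po : PartialOrder carrier]
  exists_isBot : ∃ b : carrier, IsBot b
  exists_isLUB : ∀ d : Set carrier, d.Nonempty → DirectedOn (· ≤ ·) d → ∃ a, IsLUB d a

instance : CoeSort Cpo Type := ⟨Cpo.carrier⟩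

instance (X : Cpo) : PartialOrder X := X.po

/-- An embedding-projection pair from `X` to `Y`. -/
@[ext]
structure EP (X Y : Cpo) : Type where
  e : X → Y
  p : Y → X
  e_cont : ScottContinuous e
  p_cont : ScottContinuous p
  p_e : ∀ x, p (e x) = x
  e_p : ∀ y, e (p y) ≤ y

namespace EP

theorem gc {X Y : Cpo} (f : EP X Y) : GaloisConnection f.e f.p := fun x y =>
  ⟨fun h => by simpa [f.p_e] using f.p_cont.monotone h,
   fun h => (f.e_cont.monotone h).trans (f.e_p y)⟩

/-- A continuous map with a left adjoint section is the projection of an ep-pair. -/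
def ofGC {X Y : Cpo} (e : X → Y) (p : Y → X) (h : GaloisConnection e p)
    (hp : ScottContinuous p) (hpe : ∀ x, p (e x) = x) : EP X Y where
  e := e
  p := p
  e_cont := fun _ _ _ _ ha => h.isLUB_l_image ha
  p_cont := hp
  p_e := hpe
  e_p := h.l_u_le

theorem ext_p {X Y : Cpo} {f g : EP X Y} (h : ∀ y, f.p y = g.p y) : f = g := by
  have hp : f.p = g.p := funext h
  have he : f.e = g.e := funext fun _ => f.gc.l_unique g.gc h
  exact EP.ext he hp

def id (X : Cpo) : EP X X :=
  ofGC _root_.id _root_.id GaloisConnection.id ScottContinuous.id fun _ => rfl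

def comp {X Y Z : Cpo} (f : EP X Y) (g : EP Y Z) : EP X Z where
  e := g.e ∘ f.e
  p := f.p ∘ g.p
  e_cont := f.e_cont.comp g.e_cont
  p_cont := g.p_cont.comp f.p_cont
  p_e x := by simp [g.p_e, f.p_e]
  e_p y := (g.e_cont.monotone (f.e_p _)).trans (g.e_p y)

end EP

/-- The category of cpo's and embedding-projection pairs. -/
instance : Category.{0} Cpo where
  Hom := EP
  id := EP.id
  comp := EP.comp
  id_comp _ := rfl
  comp_id _ := rfl
  assoc _ _ _ := rfl

@[simp] theorem Cpo.comp_p {X Y Z : Cpo} (f : X ⟶ Y) (g : Y ⟶ Z) (z : Z) :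
    EP.p (f ≫ g) z = EP.p f (EP.p g z) := rfl

@[simp] theorem Cpo.comp_e {X Y Z : Cpo} (f : X ⟶ Y) (g : Y ⟶ Z) (x : X) :
    EP.e (f ≫ g) x = EP.e g (EP.e f x) := rfl

@[simp] theorem Cpo.id_p {X : Cpo} (x : X) : EP.p (𝟙 X) x = x := rfl

@[simp] theorem Cpo.id_e {X : Cpo} (x : X) : EP.e (𝟙 X) x = x := rfl

namespace Cpo

theorem directedOn_image_mono {α β : Type} [PartialOrder α] [PartialOrder β] {d : Set α}
    (hd : DirectedOn (· ≤ ·) d) {f : α → β} (hf : Monotone f) :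
    DirectedOn (· ≤ ·) (f '' d) :=
  DirectedOn.mono_comp (fun _ _ h => hf h) hd

theorem isLUB_image_image {α β γ δ : Type} [PartialOrder γ] {f : α → β} {g : β → γ}
    {k : α → δ} {h : δ → γ} {d : Set α} {a b : γ} (H : IsLUB (g '' (f '' d)) a)
    (e : ∀ x ∈ d, h (k x) = g (f x)) (hab : b = a) : IsLUB (h '' (k '' d)) b := by
  rw [Set.image_image] at H ⊢
  rw [hab, Set.image_congr e]
  exact H

/-- The one-point cpo. -/
def one : Cpo where
  carrier := PUnit
  exists_isBot := ⟨⟨⟩, fun _ => trivial⟩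
  exists_isLUB := fun _ _ _ => ⟨⟨⟩, fun _ _ => trivial, fun _ _ => trivial⟩

/-- The unique morphism from the one-point cpo. -/
noncomputable def init (X : Cpo) : one ⟶ X :=
  EP.ofGC (fun _ => X.exists_isBot.choose) (fun _ => PUnit.unit)
    (fun _ y => ⟨fun _ => trivial, fun _ => X.exists_isBot.choose_spec y⟩)
    (fun _ _ _ _ _ => ⟨fun _ _ => trivial, fun _ _ => trivial⟩) fun _ => rfl

theorem one_hom_ext {X : Cpo} (f g : one ⟶ X) : f = g := EP.ext_p fun _ => rfl

/-- The two-point cpo `{⊥ < ⊤}`, with `⊥ = false` and `⊤ = true`. -/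
def two : Cpo where
  carrier := Bool
  exists_isBot := ⟨⊥, isBot_bot⟩
  exists_isLUB := fun d _ _ => ⟨sSup d, isLUB_sSup d⟩

/-! ### Products -/

/-- The Cartesian product, with the component-wise order. -/
def prodObj (X Y : Cpo) : Cpo where
  carrier := X × Y
  exists_isBot := by
    obtain ⟨b, hb⟩ := X.exists_isBot
    obtain ⟨c, hc⟩ := Y.exists_isBot
    exact ⟨(b, c), fun x => ⟨hb _, hc _⟩⟩
  exists_isLUB := fun d hd hd' => by
    obtain ⟨a, ha⟩ := X.exists_isLUB (Prod.fst '' d) (hd.image _)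
      (directedOn_image_mono hd' monotone_fst)
    obtain ⟨b, hb⟩ := Y.exists_isLUB (Prod.snd '' d) (hd.image _)
      (directedOn_image_mono hd' monotone_snd)
    exact ⟨(a, b), isLUB_prod.2 ⟨ha, hb⟩⟩

theorem scottContinuous_prodMap {X X' Y Y' : Cpo} {f : X → X'} {g : Y → Y'}
    (hf : ScottContinuous f) (hg : ScottContinuous g) :
    ScottContinuous (α := prodObj X Y) (β := prodObj X' Y') (Prod.map f g) := by
  intro d hd hd' a ha
  obtain ⟨h1, h2⟩ := isLUB_prod.1 ha
  have k1 := hf (hd.image _)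
      (directedOn_image_mono hd' monotone_fst) h1
  have k2 := hg (hd.image _)
      (directedOn_image_mono hd' monotone_snd) h2
  refine isLUB_prod.2 ⟨?_, ?_⟩
  · exact isLUB_image_image k1 (fun _ _ => rfl) rfl
  · exact isLUB_image_image k2 (fun _ _ => rfl) rfl

/-- The product functor on ep-pairs. -/
def prodF : Cpo × Cpo ⥤ Cpo where
  obj P := prodObj P.1 P.2
  map {P Q} f := EP.ofGC (X := prodObj P.1 P.2) (Y := prodObj Q.1 Q.2)
    (Prod.map (EP.e f.1) (EP.e f.2)) (Prod.map (EP.p f.1) (EP.p f.2))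
    (fun x y => and_congr (EP.gc f.1 x.1 y.1) (EP.gc f.2 x.2 y.2))
    (scottContinuous_prodMap (EP.p_cont f.1) (EP.p_cont f.2))
    (fun x => Prod.ext (EP.p_e f.1 x.1) (EP.p_e f.2 x.2))
  map_id _ := EP.ext_p fun _ => rfl
  map_comp _ _ := EP.ext_p fun _ => rfl

/-! ### Function spaces -/

/-- Scott-continuous functions. -/
@[ext]
structure Fun (X Y : Cpo) : Type where
  toFun : X → Y
  cont : ScottContinuous toFun

instance (X Y : Cpo) : CoeFun (Fun X Y) fun _ => X → Y := ⟨Fun.toFun⟩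

instance (X Y : Cpo) : PartialOrder (Fun X Y) :=
  PartialOrder.lift Fun.toFun fun _ _ => Fun.ext

theorem isLUB_fun {X Y : Cpo} {F : Set (Fun X Y)} {g : Fun X Y}
    (h : ∀ x, IsLUB ((fun f : Fun X Y => f x) '' F) (g x)) : IsLUB F g :=
  ⟨fun f hf x => (h x).1 ⟨f, hf, rfl⟩,
   fun k hk x => (h x).2 (by rintro _ ⟨f, hf, rfl⟩; exact hk hf x)⟩

theorem directedOn_eval {X Y : Cpo} {F : Set (Fun X Y)} (hF : DirectedOn (· ≤ ·) F) (x : X) :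
    DirectedOn (· ≤ ·) ((fun f : Fun X Y => f x) '' F) :=
  directedOn_image_mono hF fun _ _ h => h x

/-- Directed suprema of Scott-continuous functions exist and are computed pointwise. -/
theorem exists_pointwise {X Y : Cpo} (F : Set (Fun X Y)) (hne : F.Nonempty)
    (hF : DirectedOn (· ≤ ·) F) :
    ∃ g : Fun X Y, ∀ x, IsLUB ((fun f : Fun X Y => f x) '' F) (g x) := by
  choose g hg using fun x => Y.exists_isLUB _ (hne.image _) (directedOn_eval hF x)
  refine ⟨⟨g, ?_⟩, hg⟩
  intro d hd hd' a ha
  constructor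
  · rintro _ ⟨x, hx, rfl⟩
    refine (hg x).2 ?_
    rintro _ ⟨f, hf, rfl⟩
    exact (f.cont.monotone (ha.1 hx)).trans ((hg a).1 ⟨f, hf, rfl⟩)
  · intro b hb
    refine (hg a).2 ?_
    rintro _ ⟨f, hf, rfl⟩
    refine (f.cont hd hd' ha).2 ?_
    rintro _ ⟨x, hx, rfl⟩
    exact ((hg x).1 ⟨f, hf, rfl⟩).trans (hb ⟨x, hx, rfl⟩)

theorem isLUB_fun_iff {X Y : Cpo} {F : Set (Fun X Y)} (hne : F.Nonempty)
    (hF : DirectedOn (· ≤ ·) F) {g : Fun X Y} :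
    IsLUB F g ↔ ∀ x, IsLUB ((fun f : Fun X Y => f x) '' F) (g x) := by
  refine ⟨fun h => ?_, isLUB_fun⟩
  obtain ⟨k, hk⟩ := exists_pointwise F hne hF
  rw [h.unique (isLUB_fun hk)]
  exact hk

/-- The cpo of Scott-continuous functions, with the pointwise order. -/
def funObj (X Y : Cpo) : Cpo where
  carrier := Fun X Y
  exists_isBot := by
    obtain ⟨b, hb⟩ := Y.exists_isBot
    exact ⟨⟨fun _ => b, ScottContinuous.const b⟩, fun f x => hb _⟩
  exists_isLUB := fun F hne hF => by
    obtain ⟨g, hg⟩ := exists_pointwise F hne hF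
    exact ⟨g, isLUB_fun hg⟩

/-- Pre- and postcomposition. -/
def funMap {X X' Y Y' : Cpo} (u : X' → X) (hu : ScottContinuous u) (v : Y → Y')
    (hv : ScottContinuous v) (f : Fun X Y) : Fun X' Y' :=
  ⟨v ∘ f ∘ u, (hu.comp f.cont).comp hv⟩

theorem scottContinuous_funMap {X X' Y Y' : Cpo} (u : X' → X) (hu : ScottContinuous u)
    (v : Y → Y') (hv : ScottContinuous v) :
    ScottContinuous (α := funObj X Y) (β := funObj X' Y') (funMap u hu v hv) := by
  intro F hne hF g hg
  refine isLUB_fun fun x => ?_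
  have h := hv (hne.image _) (directedOn_eval hF (u x)) ((isLUB_fun_iff hne hF).1 hg (u x))
  exact isLUB_image_image h (fun _ _ => rfl) rfl

/-- The function space functor on ep-pairs (covariant in both arguments). -/
def funF : Cpo × Cpo ⥤ Cpo where
  obj P := funObj P.1 P.2
  map {P Q} f := EP.ofGC (X := funObj P.1 P.2) (Y := funObj Q.1 Q.2)
    (funMap (EP.p f.1) (EP.p_cont f.1) (EP.e f.2) (EP.e_cont f.2))
    (funMap (EP.e f.1) (EP.e_cont f.1) (EP.p f.2) (EP.p_cont f.2))
    (fun g h => by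
      constructor
      · intro H x
        refine (EP.gc f.2 _ _).1 ?_
        have := H (EP.e f.1 x)
        simpa [funMap, EP.p_e] using this
      · intro H y
        refine (EP.gc f.2 _ _).2 ?_
        refine (H (EP.p f.1 y)).trans ?_
        exact (EP.p_cont f.2).monotone (h.cont.monotone (EP.e_p f.1 y)))
    (scottContinuous_funMap _ _ _ _)
    (fun g => Fun.ext (funext fun x => by simp [funMap, EP.p_e]))
  map_id _ := EP.ext_p fun _ => rfl
  map_comp _ _ := EP.ext_p fun _ => rfl

/-! ### Weak sums -/

/-- The disjoint union of `X` and `Y` with a new least element. -/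
abbrev Sum' (X Y : Cpo) : Type := WithBot (X ⊕ Y)

/-- The inclusion `i` identifies `Z` with a component of `X + Y`. -/
structure IsComponent {X Y Z : Cpo} (i : Z → Sum' X Y) : Prop where
  le_iff : ∀ a b, i a ≤ i b ↔ a ≤ b
  up : ∀ a z, i a ≤ z → ∃ b, z = i b
  down : ∀ z b, z ≤ i b → z = ⊥ ∨ ∃ a, z = i a

def inl {X Y : Cpo} (x : X) : Sum' X Y := ((Sum.inl x : X ⊕ Y) : WithBot (X ⊕ Y))

def inr {X Y : Cpo} (y : Y) : Sum' X Y := ((Sum.inr y : X ⊕ Y) : WithBot (X ⊕ Y))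

theorem sum_cases {X Y : Cpo} (z : Sum' X Y) : z = ⊥ ∨ (∃ x, z = inl x) ∨ ∃ y, z = inr y := by
  induction z using WithBot.recBotCoe with
  | bot => exact Or.inl rfl
  | coe z => rcases z with x | y
             · exact Or.inr (Or.inl ⟨x, rfl⟩)
             · exact Or.inr (Or.inr ⟨y, rfl⟩)

theorem isComponent_inl {X Y : Cpo} : IsComponent (inl : X → Sum' X Y) where
  le_iff a b := by simp [inl]
  up a z h := by
    rcases sum_cases z with rfl | ⟨x, rfl⟩ | ⟨y, rfl⟩
    · simp [inl] at h
    · exact ⟨x, rfl⟩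
    · simp [inl, inr] at h
  down z b h := by
    rcases sum_cases z with rfl | ⟨x, rfl⟩ | ⟨y, rfl⟩
    · exact Or.inl rfl
    · exact Or.inr ⟨x, rfl⟩
    · simp [inl, inr] at h

theorem isComponent_inr {X Y : Cpo} : IsComponent (inr : Y → Sum' X Y) where
  le_iff a b := by simp [inr]
  up a z h := by
    rcases sum_cases z with rfl | ⟨x, rfl⟩ | ⟨y, rfl⟩
    · simp [inr] at h
    · simp [inl, inr] at h
    · exact ⟨y, rfl⟩
  down z b h := by
    rcases sum_cases z with rfl | ⟨x, rfl⟩ | ⟨y, rfl⟩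
    · exact Or.inl rfl
    · simp [inl, inr] at h
    · exact Or.inr ⟨y, rfl⟩

namespace IsComponent

variable {X Y Z : Cpo} {i : Z → Sum' X Y}

theorem isLUB (hi : IsComponent i) {A : Set Z} {d : Set (Sum' X Y)} (hA : A.Nonempty)
    (h1 : ∀ a ∈ A, i a ∈ d) (h2 : ∀ z ∈ d, z = ⊥ ∨ ∃ a ∈ A, z = i a) {a : Z} (ha : IsLUB A a) :
    IsLUB d (i a) := by
  constructor
  · intro z hz
    rcases h2 z hz with rfl | ⟨b, hb, rfl⟩
    · exact bot_le
    · exact (hi.le_iff _ _).2 (ha.1 hb)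
  · intro z hz
    obtain ⟨b, hb⟩ := hA
    obtain ⟨c, rfl⟩ := hi.up b z (hz (h1 b hb))
    exact (hi.le_iff _ _).2 (ha.2 fun x hx => (hi.le_iff _ _).1 (hz (h1 x hx)))

theorem reduce (hi : IsComponent i) {d : Set (Sum' X Y)} (hd : DirectedOn (· ≤ ·) d)
    {b : Z} (hb : i b ∈ d) :
    ∃ A : Set Z, A.Nonempty ∧ DirectedOn (· ≤ ·) A ∧ (∀ a ∈ A, i a ∈ d) ∧
      ∀ z ∈ d, z = ⊥ ∨ ∃ a ∈ A, z = i a := by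
  refine ⟨{a | i a ∈ d}, ⟨b, hb⟩, ?_, fun a ha => ha, ?_⟩
  · intro x hx y hy
    obtain ⟨z, hz, hxz, hyz⟩ := hd _ hx _ hy
    obtain ⟨c, rfl⟩ := hi.up x z hxz
    exact ⟨c, hz, (hi.le_iff _ _).1 hxz, (hi.le_iff _ _).1 hyz⟩
  · intro z hz
    obtain ⟨w, hw, hzw, hbw⟩ := hd _ hz _ hb
    obtain ⟨c, rfl⟩ := hi.up b w hbw
    rcases hi.down z c hzw with h | ⟨a, rfl⟩
    · exact Or.inl h
    · exact Or.inr ⟨a, hz, rfl⟩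

end IsComponent

theorem sum_reduce {X Y : Cpo} (d : Set (Sum' X Y)) :
    (∀ z ∈ d, z = ⊥) ∨ (∃ x : X, inl x ∈ d) ∨ ∃ y : Y, inr y ∈ d := by
  by_cases h : ∀ z ∈ d, z = ⊥
  · exact Or.inl h
  · push Not at h
    obtain ⟨z, hz, hz'⟩ := h
    rcases sum_cases z with rfl | ⟨x, rfl⟩ | ⟨y, rfl⟩
    · exact absurd rfl hz'
    · exact Or.inr (Or.inl ⟨x, hz⟩)
    · exact Or.inr (Or.inr ⟨y, hz⟩)

theorem isLUB_bot_of_forall {X Y : Cpo} {d : Set (Sum' X Y)} (h : ∀ z ∈ d, z = ⊥) :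
    IsLUB d ⊥ := ⟨fun z hz => (h z hz).le, fun _ _ => bot_le⟩

/-- The weak coproduct `(X ⨿ Y)_⊥`. -/
def sumObj (X Y : Cpo) : Cpo where
  carrier := Sum' X Y
  exists_isBot := ⟨⊥, isBot_bot⟩
  exists_isLUB := fun d _ hd' => by
    rcases sum_reduce d with h | ⟨x, hx⟩ | ⟨y, hy⟩
    · exact ⟨_, isLUB_bot_of_forall h⟩
    · obtain ⟨A, hA, hAd, h1, h2⟩ := isComponent_inl.reduce hd' hx
      obtain ⟨a, ha⟩ := X.exists_isLUB A hA hAd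
      exact ⟨_, isComponent_inl.isLUB hA h1 h2 ha⟩
    · obtain ⟨A, hA, hAd, h1, h2⟩ := isComponent_inr.reduce hd' hy
      obtain ⟨a, ha⟩ := Y.exists_isLUB A hA hAd
      exact ⟨_, isComponent_inr.isLUB hA h1 h2 ha⟩

/-- The map `f + g`, preserving the least element. -/
def sumMap {X X' Y Y' : Cpo} (f : X → X') (g : Y → Y') : sumObj X Y → sumObj X' Y' :=
  WithBot.map (Sum.map f g)

theorem scottContinuous_sumMap {X X' Y Y' : Cpo} {f : X → X'} {g : Y → Y'}
    (hf : ScottContinuous f) (hg : ScottContinuous g) : ScottContinuous (sumMap f g) := by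
  intro d hd hd' s hs
  rcases sum_reduce d with h | ⟨x, hx⟩ | ⟨y, hy⟩
  · rw [hs.unique (isLUB_bot_of_forall h)]
    refine isLUB_bot_of_forall ?_
    rintro _ ⟨z, hz, rfl⟩
    rw [h z hz]
    rfl
  · obtain ⟨A, hA, hAd, h1, h2⟩ := isComponent_inl.reduce hd' hx
    obtain ⟨a, ha⟩ := X.exists_isLUB A hA hAd
    rw [hs.unique (isComponent_inl.isLUB hA h1 h2 ha)]
    refine isComponent_inl.isLUB (hA.image f) ?_ ?_ (hf hA hAd ha)
    · rintro _ ⟨b, hb, rfl⟩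
      exact ⟨inl b, h1 b hb, rfl⟩
    · rintro _ ⟨z, hz, rfl⟩
      rcases h2 z hz with rfl | ⟨b, hb, rfl⟩
      · exact Or.inl rfl
      · exact Or.inr ⟨f b, ⟨b, hb, rfl⟩, rfl⟩
  · obtain ⟨A, hA, hAd, h1, h2⟩ := isComponent_inr.reduce hd' hy
    obtain ⟨a, ha⟩ := Y.exists_isLUB A hA hAd
    rw [hs.unique (isComponent_inr.isLUB hA h1 h2 ha)]
    refine isComponent_inr.isLUB (hA.image g) ?_ ?_ (hg hA hAd ha)
    · rintro _ ⟨b, hb, rfl⟩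
      exact ⟨inr b, h1 b hb, rfl⟩
    · rintro _ ⟨z, hz, rfl⟩
      rcases h2 z hz with rfl | ⟨b, hb, rfl⟩
      · exact Or.inl rfl
      · exact Or.inr ⟨g b, ⟨b, hb, rfl⟩, rfl⟩

theorem gc_sumMap {X X' Y Y' : Cpo} (f : EP X X') (g : EP Y Y') :
    GaloisConnection (sumMap f.e g.e) (sumMap f.p g.p) := by
  intro x y
  rcases sum_cases x with rfl | ⟨x, rfl⟩ | ⟨x, rfl⟩
  · exact ⟨fun _ => bot_le (α := Sum' X Y), fun _ => bot_le (α := Sum' X' Y')⟩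
  · rcases sum_cases y with rfl | ⟨y, rfl⟩ | ⟨y, rfl⟩
    · exact ⟨fun h => absurd h (WithBot.not_coe_le_bot _),
        fun h => absurd h (WithBot.not_coe_le_bot _)⟩
    · exact (isComponent_inl.le_iff _ _).trans ((f.gc x y).trans (isComponent_inl.le_iff _ _).symm)
    · exact ⟨fun h => absurd (WithBot.coe_le_coe.1 h) Sum.not_inl_le_inr,
        fun h => absurd (WithBot.coe_le_coe.1 h) Sum.not_inl_le_inr⟩
  · rcases sum_cases y with rfl | ⟨y, rfl⟩ | ⟨y, rfl⟩
    · exact ⟨fun h => absurd h (WithBot.not_coe_le_bot _),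
        fun h => absurd h (WithBot.not_coe_le_bot _)⟩
    · exact ⟨fun h => absurd (WithBot.coe_le_coe.1 h) Sum.not_inr_le_inl,
        fun h => absurd (WithBot.coe_le_coe.1 h) Sum.not_inr_le_inl⟩
    · exact (isComponent_inr.le_iff _ _).trans ((g.gc x y).trans (isComponent_inr.le_iff _ _).symm)

/-- The weak coproduct functor on ep-pairs. -/
def sumF : Cpo × Cpo ⥤ Cpo where
  obj P := sumObj P.1 P.2
  map {P Q} f := EP.ofGC (X := sumObj P.1 P.2) (Y := sumObj Q.1 Q.2)
    (sumMap (EP.e f.1) (EP.e f.2)) (sumMap (EP.p f.1) (EP.p f.2))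
    (gc_sumMap f.1 f.2)
    (scottContinuous_sumMap (EP.p_cont f.1) (EP.p_cont f.2))
    (fun x => by
      rcases sum_cases x with rfl | ⟨x, rfl⟩ | ⟨x, rfl⟩
      · rfl
      · exact congrArg inl (EP.p_e f.1 x)
      · exact congrArg inr (EP.p_e f.2 x))
  map_id _ := EP.ext_p fun x => by
    rcases sum_cases x with rfl | ⟨x, rfl⟩ | ⟨x, rfl⟩ <;> rfl
  map_comp _ _ := EP.ext_p fun x => by
    rcases sum_cases x with rfl | ⟨x, rfl⟩ | ⟨x, rfl⟩ <;> rfl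

/-! ### Colimits of `ω`-chains of embeddings -/

/-- The points of the limit of the projections of an `ω`-chain of ep-pairs. -/
@[ext]
structure Thread (K : ℕ ⥤ Cpo) : Type where
  coord : ∀ n, K.obj n
  compat : ∀ {m n : ℕ} (f : m ⟶ n), EP.p (K.map f) (coord n) = coord m

instance (K : ℕ ⥤ Cpo) : PartialOrder (Thread K) :=
  PartialOrder.lift Thread.coord fun _ _ => Thread.ext

theorem isLUB_thread {K : ℕ ⥤ Cpo} {d : Set (Thread K)} {a : Thread K}
    (h : ∀ n, IsLUB ((fun x : Thread K => x.coord n) '' d) (a.coord n)) : IsLUB d a :=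
  ⟨fun x hx n => (h n).1 ⟨x, hx, rfl⟩,
   fun b hb n => (h n).2 (by rintro _ ⟨x, hx, rfl⟩; exact hb hx n)⟩

theorem directedOn_coord {K : ℕ ⥤ Cpo} {d : Set (Thread K)} (hd : DirectedOn (· ≤ ·) d) (n : ℕ) :
    DirectedOn (· ≤ ·) ((fun x : Thread K => x.coord n) '' d) :=
  directedOn_image_mono hd fun _ _ h => h n

theorem exists_lub_thread {K : ℕ ⥤ Cpo} (d : Set (Thread K)) (hne : d.Nonempty)
    (hd : DirectedOn (· ≤ ·) d) :
    ∃ a : Thread K, ∀ n, IsLUB ((fun x : Thread K => x.coord n) '' d) (a.coord n) := by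
  choose a ha using fun n => (K.obj n).exists_isLUB _ (hne.image _) (directedOn_coord hd n)
  refine ⟨⟨a, fun {m n} f => ?_⟩, ha⟩
  have h := EP.p_cont (K.map f) (hne.image _) (directedOn_coord hd n) (ha n)
  rw [Set.image_image, Set.image_congr fun x _ => x.compat f] at h
  exact h.unique (ha m)

theorem isLUB_thread_iff {K : ℕ ⥤ Cpo} {d : Set (Thread K)} (hne : d.Nonempty)
    (hd : DirectedOn (· ≤ ·) d) {a : Thread K} :
    IsLUB d a ↔ ∀ n, IsLUB ((fun x : Thread K => x.coord n) '' d) (a.coord n) := by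
  refine ⟨fun h => ?_, isLUB_thread⟩
  obtain ⟨b, hb⟩ := exists_lub_thread d hne hd
  rw [h.unique (isLUB_thread hb)]
  exact hb

theorem p_comp {K : ℕ ⥤ Cpo} {l m n : ℕ} (f : l ⟶ m) (g : m ⟶ n) (h : l ⟶ n) (x : K.obj n) :
    EP.p (K.map f) (EP.p (K.map g) x) = EP.p (K.map h) x := by
  rw [Subsingleton.elim h (f ≫ g), K.map_comp]
  rfl

theorem e_comp {K : ℕ ⥤ Cpo} {l m n : ℕ} (f : l ⟶ m) (g : m ⟶ n) (h : l ⟶ n) (x : K.obj l) :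
    EP.e (K.map g) (EP.e (K.map f) x) = EP.e (K.map h) x := by
  rw [Subsingleton.elim h (f ≫ g), K.map_comp]
  rfl

/-- The map `K n → K m` obtained by going up to `K (max n m)` and then down. -/
def transfer (K : ℕ ⥤ Cpo) (n m : ℕ) (x : K.obj n) : K.obj m :=
  EP.p (K.map (homOfLE (le_max_right n m))) (EP.e (K.map (homOfLE (le_max_left n m))) x)

theorem transfer_eq (K : ℕ ⥤ Cpo) {n m N : ℕ} (f : n ⟶ N) (g : m ⟶ N) (x : K.obj n) :
    EP.p (K.map g) (EP.e (K.map f) x) = transfer K n m x := by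
  have hN : max n m ≤ N := max_le (leOfHom f) (leOfHom g)
  rw [← e_comp (homOfLE (le_max_left n m)) (homOfLE hN) f,
    ← p_comp (homOfLE (le_max_right n m)) (homOfLE hN) g, EP.p_e]
  rfl

/-- The embedding of `K n` in the limit. -/
def embed (K : ℕ ⥤ Cpo) (n : ℕ) (x : K.obj n) : Thread K :=
  ⟨fun m => transfer K n m x, fun {m m'} f => by
    rw [← transfer_eq K (homOfLE (le_max_left n m')) (f ≫ homOfLE (le_max_right n m')),
      transfer, p_comp f]⟩

theorem embed_least (K : ℕ ⥤ Cpo) : IsBot (embed K 0 (K.obj 0).exists_isBot.choose) := by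
  intro x m
  rw [embed]
  dsimp only
  rw [← transfer_eq K (homOfLE (Nat.zero_le m)) (𝟙 m), K.map_id]
  exact (EP.gc _ _ _).2 ((K.obj 0).exists_isBot.choose_spec _)

/-- The limit of the projections, with the pointwise order. -/
def bilim (K : ℕ ⥤ Cpo) : Cpo where
  carrier := Thread K
  exists_isBot := ⟨_, embed_least K⟩
  exists_isLUB := fun d hne hd =>
    let ⟨a, ha⟩ := exists_lub_thread d hne hd
    ⟨a, isLUB_thread ha⟩

/-- The `n`-th component of the colimiting cocone: its projection is evaluation at `n`. -/
def leg (K : ℕ ⥤ Cpo) (n : ℕ) : K.obj n ⟶ bilim K :=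
  EP.ofGC (Y := bilim K) (embed K n) (fun x : Thread K => x.coord n)
    (fun y (x : Thread K) => by
      constructor
      · intro h
        have : transfer K n n y ≤ x.coord n := h n
        rwa [ ← transfer_eq K (𝟙 n) (𝟙 n), K.map_id] at this
      · intro h m
        rw [embed]
        have h1 : EP.e (K.map (homOfLE (le_max_left n m))) y ≤ x.coord (max n m) :=
          (EP.gc _ _ _).2 (by rw [x.compat]; exact h)
        have h2 := (EP.p_cont (K.map (homOfLE (le_max_right n m)))).monotone h1
        rwa [x.compat] at h2)
    (fun d hne hd a ha => (isLUB_thread_iff hne hd).1 ha n)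
    (fun y => by
      rw [embed]
      dsimp only
      rw [← transfer_eq K (𝟙 n) (𝟙 n), K.map_id]
      rfl)

def bilimCocone (K : ℕ ⥤ Cpo) : Limits.Cocone K where
  pt := bilim K
  ι := { app := leg K
         naturality := fun _ _ f => EP.ext_p fun x : Thread K => x.compat f }

theorem monotone_desc {K : ℕ ⥤ Cpo} (c : Limits.Cocone K) (x : Thread K) :
    Monotone fun n => EP.e (c.ι.app n) (x.coord n) := by
  intro m n h
  dsimp only
  rw [← c.w (homOfLE h), Cpo.comp_e, ← x.compat (homOfLE h)]
  exact (EP.e_cont (c.ι.app n)).monotone (EP.e_p _ _)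

theorem exists_desc {K : ℕ ⥤ Cpo} (c : Limits.Cocone K) (x : Thread K) :
    ∃ y, IsLUB (Set.range fun n => EP.e (c.ι.app n) (x.coord n)) y :=
  c.pt.exists_isLUB _ (Set.range_nonempty _)
    (directedOn_range.2 (monotone_desc c x).directed_le)

/-- The mediating morphism out of the colimit: `x ↦ ⨆ₙ eₙ (xₙ)`, with projection
`y ↦ (pₙ y)ₙ`. -/
noncomputable def bilimDesc {K : ℕ ⥤ Cpo} (c : Limits.Cocone K) : bilim K ⟶ c.pt :=
  EP.ofGC (X := bilim K) (fun x => (exists_desc c x).choose)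
    (fun y => (⟨fun n => EP.p (c.ι.app n) y, fun f => by
      rw [← Cpo.comp_p, c.w]⟩ : Thread K))
    (fun (x : Thread K) y => by
      refine (isLUB_le_iff (exists_desc c x).choose_spec).trans ?_
      constructor
      · intro h n
        exact (EP.gc _ _ _).1 (h ⟨n, rfl⟩)
      · rintro h _ ⟨n, rfl⟩
        exact (EP.gc _ _ _).2 (h n))
    (fun d hne hd a ha => isLUB_thread fun n => by
      have h := EP.p_cont (c.ι.app n) hne hd ha
      rw [← Set.image_id (_ '' d)] at h
      exact isLUB_image_image h (fun _ _ => rfl) rfl)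
    (fun (x : Thread K) => Thread.ext (funext fun m => by
      have h := EP.p_cont (c.ι.app m) (Set.range_nonempty _)
        (directedOn_range.2 (monotone_desc c x).directed_le) (exists_desc c x).choose_spec
      refine h.unique ?_
      constructor
      · rintro _ ⟨_, ⟨n, rfl⟩, rfl⟩
        have h1 := monotone_desc c x (le_max_left n m)
        refine ((EP.p_cont (c.ι.app m)).monotone h1).trans ?_
        dsimp only
        rw [← c.w (homOfLE (le_max_right n m)), Cpo.comp_p, EP.p_e, x.compat]
      · intro b hb
        have := hb ⟨_, ⟨m, rfl⟩, rfl⟩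
        simpa [EP.p_e] using this))

/-- The limit of the projections is the colimit of the chain of ep-pairs. -/
noncomputable def bilimIsColimit (K : ℕ ⥤ Cpo) : Limits.IsColimit (bilimCocone K) where
  desc c := bilimDesc c
  fac c n := EP.ext_p fun y => rfl
  uniq c m hm := EP.ext_p fun y => Thread.ext (funext fun n => by
    have h : EP.p ((bilimCocone K).ι.app n ≫ m) y = EP.p (c.ι.app n) y := by rw [hm n]
    exact h)

/-- The colimit functor on `ω`-chains of ep-pairs. -/
noncomputable def bilimF : (ℕ ⥤ Cpo) ⥤ Cpo where
  obj := bilim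
  map {K L} α := (bilimIsColimit K).map (bilimCocone L) α
  map_id K := (bilimIsColimit K).hom_ext fun n => by
    rw [Limits.IsColimit.ι_map]; rfl
  map_comp {K L M} α β := (bilimIsColimit K).hom_ext fun n => by
    refine (Limits.IsColimit.ι_map _ _ _ _).trans ?_
    have h1 := (bilimIsColimit K).ι_map (bilimCocone L) α n
    have h2 := (bilimIsColimit L).ι_map (bilimCocone M) β n
    change (α.app n ≫ β.app n) ≫ leg M n = leg K n ≫ _ ≫ _
    rw [Category.assoc]
    refine (congrArg (α.app n ≫ ·) h2.symm).trans ?_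
    exact (Category.assoc _ _ _).symm.trans ((congrArg (· ≫ _) h1.symm).trans
      (Category.assoc _ _ _))

/-! ### Fixpoints of endofunctors -/

/-- The iterates `F^n(1)`. -/
def iter (F : Cpo ⥤ Cpo) : ℕ → Cpo
  | 0 => one
  | n + 1 => F.obj (iter F n)

/-- The connecting morphisms `F^n(1) ⟶ F^(n+1)(1)`. -/
noncomputable def iterStep (F : Cpo ⥤ Cpo) : ∀ n, iter F n ⟶ iter F (n + 1)
  | 0 => init _
  | n + 1 => F.map (iterStep F n)

/-- The chain `1 ⟶ F(1) ⟶ F²(1) ⟶ ⋯`. -/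
noncomputable def chain (F : Cpo ⥤ Cpo) : ℕ ⥤ Cpo := Functor.ofSequence (iterStep F)

def iterMap {F G : Cpo ⥤ Cpo} (α : F ⟶ G) : ∀ n, iter F n ⟶ iter G n
  | 0 => 𝟙 _
  | n + 1 => α.app _ ≫ G.map (iterMap α n)

theorem iterMap_naturality {F G : Cpo ⥤ Cpo} (α : F ⟶ G) :
    ∀ n, iterStep F n ≫ iterMap α (n + 1) = iterMap α n ≫ iterStep G n
  | 0 => one_hom_ext _ _
  | n + 1 => by
    have ih := iterMap_naturality α n
    change F.map _ ≫ α.app _ ≫ G.map (iterMap α (n + 1)) =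
      (α.app _ ≫ G.map _) ≫ G.map (iterStep G n)
    rw [← Category.assoc, α.naturality, Category.assoc, ← G.map_comp, ih, Category.assoc,
      ← G.map_comp]

noncomputable def chainMap {F G : Cpo ⥤ Cpo} (α : F ⟶ G) : chain F ⟶ chain G :=
  NatTrans.ofSequence (F := chain F) (G := chain G) (iterMap α) fun n => by
    simp only [chain, Functor.ofSequence_map_homOfLE_succ]
    exact iterMap_naturality α n

noncomputable def chainF : (Cpo ⥤ Cpo) ⥤ (ℕ ⥤ Cpo) where
  obj := chain
  map := chainMap
  map_id F := by
    ext n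
    induction n with
    | zero => rfl
    | succ n ih =>
      change (𝟙 F : F ⟶ F).app _ ≫ F.map ((chainMap (𝟙 F)).app n) = 𝟙 _
      rw [ih]
      exact (Category.id_comp _).trans (F.map_id _)
  map_comp {F G H} α β := by
    ext n
    induction n with
    | zero => rfl
    | succ n ih =>
      change (α ≫ β).app _ ≫ H.map ((chainMap (α ≫ β)).app n) =
        (α.app _ ≫ G.map ((chainMap α).app n)) ≫ β.app _ ≫ H.map ((chainMap β).app n)
      rw [ih]
      change (α.app _ ≫ β.app _) ≫ H.map ((chainMap α).app n ≫ (chainMap β).app n) = _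
      rw [H.map_comp, Category.assoc, Category.assoc]
      congr 1
      rw [← Category.assoc, ← Category.assoc, ← β.naturality]

/-- `Fix F` is the colimit of `1 ⟶ F(1) ⟶ F²(1) ⟶ ⋯`, functorially in `F`. -/
noncomputable def fixF : (Cpo ⥤ Cpo) ⥤ Cpo := chainF ⋙ bilimF

/-- The cocone with components `F (γₙ) : F^(n+1)(1) ⟶ F (Fix F)`. -/
noncomputable def unfoldCocone (F : Cpo ⥤ Cpo) : Limits.Cocone (chain F) where
  pt := F.obj (fixF.obj F)
  ι := NatTrans.ofSequence (F := chain F)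
    (G := (Functor.const ℕ).obj (F.obj (fixF.obj F)))
    (fun n => match n with
      | 0 => init _
      | n + 1 => F.map (leg (chain F) n))
    (fun n => by
      simp only [chain, Functor.ofSequence_map_homOfLE_succ]
      cases n with
      | zero => exact one_hom_ext _ _
      | succ n =>
        have h := (bilimCocone (chain F)).w (homOfLE (Nat.le_succ n))
        simp only [chain, Functor.ofSequence_map_homOfLE_succ] at h
        change F.map (iterStep F n) ≫ F.map (leg (chain F) (n + 1)) =
          F.map (leg (chain F) n) ≫ 𝟙 _
        exact (F.map_comp _ _).symm.trans ((congrArg F.map h).trans (Category.comp_id _).symm))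

/-- The comparison morphism `Fix F ⟶ F (Fix F)` given by the universal property of the colimit
`Fix F` of the chain `F^n(1)`. It is an isomorphism whenever `F` preserves colimits of
`ω`-chains, as do all the functors interpreting type expressions. -/
noncomputable def unfoldEP (F : Cpo ⥤ Cpo) : fixF.obj F ⟶ F.obj (fixF.obj F) :=
  (bilimIsColimit (chain F)).desc (unfoldCocone F)

end Cpo

/-! ## Interpretation of pure types -/

namespace TyExpr

/-- The interpretation of a type expression, as a functor on ep-pairs, given functors interpreting
its free variables. Recursive types are interpreted by `Fix`. -/
noncomputable def sem : {n : ℕ} → TyExpr n → (D : Type 1) → [Category.{0} D] →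
    (Fin n → D ⥤ Cpo) → D ⥤ Cpo
  | _, unit, _, _, _ => (Functor.const _).obj Cpo.two
  | _, prod σ τ, D, _, φ => (σ.sem D φ).prod' (τ.sem D φ) ⋙ Cpo.prodF
  | _, arrow σ τ, D, _, φ => (σ.sem D φ).prod' (τ.sem D φ) ⋙ Cpo.funF
  | _, sum σ τ, D, _, φ => (σ.sem D φ).prod' (τ.sem D φ) ⋙ Cpo.sumF
  | _, var i, _, _, φ => φ i
  | _, mu τ, D, _, φ =>
    Functor.curry.obj (τ.sem (D × Cpo)
      (Fin.cases (CategoryTheory.Prod.snd D Cpo) fun i => CategoryTheory.Prod.fst D Cpo ⋙ φ i)) ⋙ Cpo.fixF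

theorem curry_comp {D E : Type 1} [Category.{0} D] [Category.{0} E] (H : E ⥤ D)
    (G : D × Cpo ⥤ Cpo) :
    Functor.curry.obj (H.prod (𝟭 Cpo) ⋙ G) = H ⋙ Functor.curry.obj G := by
  apply Functor.uncurry_obj_injective
  rw [Functor.uncurry_obj_curry_obj]
  conv_lhs => rw [← Functor.uncurry_obj_curry_obj G]
  rfl

theorem sem_comp {n : ℕ} (τ : TyExpr n) {D E : Type 1} [Category.{0} D] [Category.{0} E]
    (H : E ⥤ D) (φ : Fin n → D ⥤ Cpo) :
    τ.sem E (fun i => H ⋙ φ i) = H ⋙ τ.sem D φ := by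
  induction τ generalizing D E with
  | unit => rfl
  | prod σ τ h1 h2 => simp only [sem, h1, h2]; rfl
  | arrow σ τ h1 h2 => simp only [sem, h1, h2]; rfl
  | sum σ τ h1 h2 => simp only [sem, h1, h2]; rfl
  | var i => rfl
  | mu τ ih =>
    simp only [sem]
    rw [← Functor.assoc, ← curry_comp, ← ih]
    congr 3
    funext i
    refine Fin.cases ?_ (fun i => ?_) i <;> rfl

theorem sem_ren {n m : ℕ} (τ : TyExpr n) (r : Fin n → Fin m) {D : Type 1} [Category.{0} D]
    (φ : Fin m → D ⥤ Cpo) : (τ.ren r).sem D φ = τ.sem D fun i => φ (r i) := by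
  induction τ generalizing m D with
  | unit => rfl
  | prod σ τ h1 h2 => simp only [ren, sem, h1, h2]
  | arrow σ τ h1 h2 => simp only [ren, sem, h1, h2]
  | sum σ τ h1 h2 => simp only [ren, sem, h1, h2]
  | var i => rfl
  | mu τ ih =>
    simp only [ren, sem, ih]
    congr 3
    funext i
    refine Fin.cases ?_ (fun i => ?_) i <;> rfl

/-- Substitution is interpreted by composition. -/
theorem sem_subst {n m : ℕ} (τ : TyExpr n) (s : Fin n → TyExpr m) {D : Type 1} [Category.{0} D]
    (φ : Fin m → D ⥤ Cpo) : (τ.subst s).sem D φ = τ.sem D fun i => (s i).sem D φ := by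
  induction τ generalizing m D with
  | unit => rfl
  | prod σ τ h1 h2 => simp only [subst, sem, h1, h2]
  | arrow σ τ h1 h2 => simp only [subst, sem, h1, h2]
  | sum σ τ h1 h2 => simp only [subst, sem, h1, h2]
  | var i => rfl
  | mu τ ih =>
    simp only [subst, sem, ih]
    congr 3
    funext i
    refine Fin.cases ?_ (fun i => ?_) i
    · rfl
    · exact (sem_ren _ _ _).trans (sem_comp _ (CategoryTheory.Prod.fst D Cpo) φ)

/-- The functor `(CPO^ep)^n ⥤ CPO^ep` interpreting a type expression with `n` free variables. -/
noncomputable def interp {n : ℕ} (τ : TyExpr n) : (Fin n → Cpo) ⥤ Cpo :=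
  τ.sem (Fin n → Cpo) fun i => Pi.eval (fun _ => Cpo) i

/-- The endofunctor `X ↦ ⟦τ⟧(X)` of which `⟦mu τ⟧` is the fixpoint. -/
noncomputable def endo (τ : TyExpr 1) : Cpo ⥤ Cpo :=
  (Functor.curry.obj (τ.sem ((Fin 0 → Cpo) × Cpo)
    (Fin.cases (CategoryTheory.Prod.snd _ Cpo) fun i => CategoryTheory.Prod.fst _ Cpo ⋙ Pi.eval (fun _ => Cpo) i))).obj Fin.elim0

/-- The Scott domain interpreting a pure type. -/
noncomputable def dom (τ : PureType) : Cpo := τ.interp.obj Fin.elim0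

theorem dom_mu (τ : TyExpr 1) : dom (mu τ) = Cpo.fixF.obj τ.endo := rfl

theorem dom_unroll (τ : TyExpr 1) : dom τ.unroll = τ.endo.obj (dom (mu τ)) := by
  have h := sem_comp τ
    ((𝟭 (Fin 0 → Cpo)).prod' (mu τ).interp)
    (Fin.cases (CategoryTheory.Prod.snd _ Cpo) fun i =>
      CategoryTheory.Prod.fst _ Cpo ⋙ Pi.eval (fun _ => Cpo) i)
  have h' : (fun i : Fin 1 => ((𝟭 (Fin 0 → Cpo)).prod' (mu τ).interp) ⋙
      (Fin.cases (CategoryTheory.Prod.snd _ Cpo) fun i =>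
        CategoryTheory.Prod.fst _ Cpo ⋙ Pi.eval (fun _ => Cpo) i :
          Fin 1 → (Fin 0 → Cpo) × Cpo ⥤ Cpo) i) = fun _ => (mu τ).interp := by
    funext i
    refine Fin.cases ?_ (fun i => i.elim0) i
    rfl
  rw [h'] at h
  have hs := sem_subst τ (fun _ => mu τ) fun i : Fin 0 => Pi.eval (fun _ => Cpo) i
  exact congrArg (fun F : (Fin 0 → Cpo) ⥤ Cpo => F.obj Fin.elim0) (hs.trans h)

end TyExpr

namespace PureType

open TyExpr

/-- The set of points of the domain interpreting a pure type. -/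
abbrev Dom (τ : PureType) : Type := τ.dom

def fstMap {σ τ : PureType} (x : Dom (prod σ τ)) : Dom σ :=
  let x' : Dom σ × Dom τ := x
  x'.1

def sndMap {σ τ : PureType} (x : Dom (prod σ τ)) : Dom τ :=
  let x' : Dom σ × Dom τ := x
  x'.2

def inlMap {σ τ : PureType} (x : Dom σ) : Dom (sum σ τ) :=
  ((Sum.inl x : Dom σ ⊕ Dom τ) : WithBot (Dom σ ⊕ Dom τ))

def inrMap {σ τ : PureType} (y : Dom τ) : Dom (sum σ τ) :=
  ((Sum.inr y : Dom σ ⊕ Dom τ) : WithBot (Dom σ ⊕ Dom τ))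

/-- The element `⊤` of the two-point domain. -/
def top : Dom unit := true

/-- Application of an element of the function space. -/
def app {σ τ : PureType} (f : Dom (arrow σ τ)) (x : Dom σ) : Dom τ :=
  let f' : Cpo.Fun σ.dom τ.dom := f
  f' x

/-- The map `⟦mu τ⟧ → ⟦τ[mu τ]⟧`. -/
noncomputable def unfold {τ : TyExpr 1} (x : Dom (mu τ)) : Dom τ.unroll :=
  cast (congrArg Cpo.carrier (dom_unroll τ).symm) (EP.e (Cpo.unfoldEP τ.endo) x)

end PureType

/-! ## Formulae -/

/-- Iteration terms; iteration variables are de Bruijn indices. -/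
inductive ITerm : Type
  | var (k : ℕ) : ITerm
  | zero : ITerm
  | succ (t : ITerm) : ITerm

namespace ITerm

/-- The iteration variable `k` occurs in the term. -/
def Occurs (k : ℕ) : ITerm → Prop
  | var j => j = k
  | zero => False
  | succ t => t.Occurs k

def eval (δ : ℕ → ℕ) : ITerm → ℕ
  | var k => δ k
  | zero => 0
  | succ t => t.eval δ + 1

def ren (f : ℕ → ℕ) : ITerm → ITerm
  | var k => var (f k)
  | zero => zero
  | succ t => succ (t.ren f)

theorem eval_ren (f δ : ℕ → ℕ) (t : ITerm) : (t.ren f).eval δ = t.eval (δ ∘ f) := by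
  induction t with
  | var k => rfl
  | zero => rfl
  | succ t ih => simp [ren, eval, ih]

end ITerm

/-- A fixpoint context: `n` fixpoint variables with their types. -/
abbrev FCtx (n : ℕ) : Type := Fin n → PureType

/-- Typed formulae over a fixpoint context, before the polarity constraints.
`mu t φ` and `nu t φ` are the bounded iterations `(μ^t X)φ` and `(ν^t X)φ`; they bind the
fixpoint variable `0`, while `ex` and `all` bind the iteration variable `0`. -/
inductive Form : {n : ℕ} → FCtx n → PureType → Type
  | tt {n : ℕ} {Δ : FCtx n} {τ : PureType} : Form Δ τ
  | ff {n : ℕ} {Δ : FCtx n} {τ : PureType} : Form Δ τ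
  | and {n : ℕ} {Δ : FCtx n} {τ : PureType} (φ ψ : Form Δ τ) : Form Δ τ
  | or {n : ℕ} {Δ : FCtx n} {τ : PureType} (φ ψ : Form Δ τ) : Form Δ τ
  | triv {n : ℕ} {Δ : FCtx n} : Form Δ TyExpr.unit
  | fst {n : ℕ} {Δ : FCtx n} {σ τ : PureType} (φ : Form Δ σ) : Form Δ (TyExpr.prod σ τ)
  | snd {n : ℕ} {Δ : FCtx n} {σ τ : PureType} (φ : Form Δ τ) : Form Δ (TyExpr.prod σ τ)
  | inl {n : ℕ} {Δ : FCtx n} {σ τ : PureType} (φ : Form Δ σ) : Form Δ (TyExpr.sum σ τ)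
  | inr {n : ℕ} {Δ : FCtx n} {σ τ : PureType} (φ : Form Δ τ) : Form Δ (TyExpr.sum σ τ)
  | fold {n : ℕ} {Δ : FCtx n} {τ : TyExpr 1} (φ : Form Δ τ.unroll) : Form Δ (TyExpr.mu τ)
  | var {n : ℕ} {Δ : FCtx n} {τ : PureType} (i : Fin n) (h : Δ i = τ) : Form Δ τ
  | mu {n : ℕ} {Δ : FCtx n} {τ : PureType} (t : ITerm)
      (φ : Form (Fin.cons τ Δ : FCtx (n + 1)) τ) : Form Δ τ
  | nu {n : ℕ} {Δ : FCtx n} {τ : PureType} (t : ITerm)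
      (φ : Form (Fin.cons τ Δ : FCtx (n + 1)) τ) : Form Δ τ
  | ex {n : ℕ} {Δ : FCtx n} {τ : PureType} (φ : Form Δ τ) : Form Δ τ
  | all {n : ℕ} {Δ : FCtx n} {τ : PureType} (φ : Form Δ τ) : Form Δ τ
  | imp {n : ℕ} {Δ : FCtx n} {σ τ : PureType} (ψ : Form (Fin.elim0 : FCtx 0) σ)
      (φ : Form (Fin.elim0 : FCtx 0) τ) : Form Δ (TyExpr.arrow σ τ)

namespace Form

/-- The iteration variable `k` occurs free in the formula. -/
def Occurs : {n : ℕ} → {Δ : FCtx n} → {τ : PureType} → ℕ → Form Δ τ → Prop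
  | _, _, _, _, tt => False
  | _, _, _, _, ff => False
  | _, _, _, k, and φ ψ => φ.Occurs k ∨ ψ.Occurs k
  | _, _, _, k, or φ ψ => φ.Occurs k ∨ ψ.Occurs k
  | _, _, _, _, triv => False
  | _, _, _, k, fst φ => φ.Occurs k
  | _, _, _, k, snd φ => φ.Occurs k
  | _, _, _, k, inl φ => φ.Occurs k
  | _, _, _, k, inr φ => φ.Occurs k
  | _, _, _, k, fold φ => φ.Occurs k
  | _, _, _, _, var _ _ => False
  | _, _, _, k, mu t φ => t.Occurs k ∨ φ.Occurs k
  | _, _, _, k, nu t φ => t.Occurs k ∨ φ.Occurs k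
  | _, _, _, k, ex φ => φ.Occurs (k + 1)
  | _, _, _, k, all φ => φ.Occurs (k + 1)
  | _, _, _, k, imp ψ φ => ψ.Occurs k ∨ φ.Occurs k

mutual

/-- The iteration variable `k` is positive in the formula. -/
inductive Pos : {n : ℕ} → {Δ : FCtx n} → {τ : PureType} → ℕ → Form Δ τ → Prop
  | notFree {n : ℕ} {Δ : FCtx n} {τ : PureType} {k : ℕ} {φ : Form Δ τ} :
      ¬ φ.Occurs k → Pos k φ
  | and {n : ℕ} {Δ : FCtx n} {τ : PureType} {k : ℕ} {φ ψ : Form Δ τ} :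
      Pos k φ → Pos k ψ → Pos k (φ.and ψ)
  | or {n : ℕ} {Δ : FCtx n} {τ : PureType} {k : ℕ} {φ ψ : Form Δ τ} :
      Pos k φ → Pos k ψ → Pos k (φ.or ψ)
  | fst {n : ℕ} {Δ : FCtx n} {σ τ : PureType} {k : ℕ} {φ : Form Δ σ} :
      Pos k φ → Pos k (φ.fst : Form Δ (TyExpr.prod σ τ))
  | snd {n : ℕ} {Δ : FCtx n} {σ τ : PureType} {k : ℕ} {φ : Form Δ τ} :
      Pos k φ → Pos k (φ.snd : Form Δ (TyExpr.prod σ τ))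
  | inl {n : ℕ} {Δ : FCtx n} {σ τ : PureType} {k : ℕ} {φ : Form Δ σ} :
      Pos k φ → Pos k (φ.inl : Form Δ (TyExpr.sum σ τ))
  | inr {n : ℕ} {Δ : FCtx n} {σ τ : PureType} {k : ℕ} {φ : Form Δ τ} :
      Pos k φ → Pos k (φ.inr : Form Δ (TyExpr.sum σ τ))
  | fold {n : ℕ} {Δ : FCtx n} {τ : TyExpr 1} {k : ℕ} {φ : Form Δ τ.unroll} :
      Pos k φ → Pos k φ.fold
  | imp {n : ℕ} {Δ : FCtx n} {σ τ : PureType} {k : ℕ} {ψ : Form (Fin.elim0 : FCtx 0) σ}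
      {φ : Form (Fin.elim0 : FCtx 0) τ} :
      Neg k ψ → Pos k φ → Pos k (ψ.imp φ : Form Δ (TyExpr.arrow σ τ))
  | ex {n : ℕ} {Δ : FCtx n} {τ : PureType} {k : ℕ} {φ : Form Δ τ} :
      Pos (k + 1) φ → Pos k φ.ex
  | mu {n : ℕ} {Δ : FCtx n} {τ : PureType} {k : ℕ} {t : ITerm}
      {φ : Form (Fin.cons τ Δ : FCtx (n + 1)) τ} :
      Pos k φ → Pos k (φ.mu t)
  | nu {n : ℕ} {Δ : FCtx n} {τ : PureType} {k : ℕ} {t : ITerm}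
      {φ : Form (Fin.cons τ Δ : FCtx (n + 1)) τ} :
      Pos k φ → ¬ t.Occurs k → Pos k (φ.nu t)

/-- The iteration variable `k` is negative in the formula. -/
inductive Neg : {n : ℕ} → {Δ : FCtx n} → {τ : PureType} → ℕ → Form Δ τ → Prop
  | notFree {n : ℕ} {Δ : FCtx n} {τ : PureType} {k : ℕ} {φ : Form Δ τ} :
      ¬ φ.Occurs k → Neg k φ
  | and {n : ℕ} {Δ : FCtx n} {τ : PureType} {k : ℕ} {φ ψ : Form Δ τ} :
      Neg k φ → Neg k ψ → Neg k (φ.and ψ)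
  | or {n : ℕ} {Δ : FCtx n} {τ : PureType} {k : ℕ} {φ ψ : Form Δ τ} :
      Neg k φ → Neg k ψ → Neg k (φ.or ψ)
  | fst {n : ℕ} {Δ : FCtx n} {σ τ : PureType} {k : ℕ} {φ : Form Δ σ} :
      Neg k φ → Neg k (φ.fst : Form Δ (TyExpr.prod σ τ))
  | snd {n : ℕ} {Δ : FCtx n} {σ τ : PureType} {k : ℕ} {φ : Form Δ τ} :
      Neg k φ → Neg k (φ.snd : Form Δ (TyExpr.prod σ τ))
  | inl {n : ℕ} {Δ : FCtx n} {σ τ : PureType} {k : ℕ} {φ : Form Δ σ} :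
      Neg k φ → Neg k (φ.inl : Form Δ (TyExpr.sum σ τ))
  | inr {n : ℕ} {Δ : FCtx n} {σ τ : PureType} {k : ℕ} {φ : Form Δ τ} :
      Neg k φ → Neg k (φ.inr : Form Δ (TyExpr.sum σ τ))
  | fold {n : ℕ} {Δ : FCtx n} {τ : TyExpr 1} {k : ℕ} {φ : Form Δ τ.unroll} :
      Neg k φ → Neg k φ.fold
  | imp {n : ℕ} {Δ : FCtx n} {σ τ : PureType} {k : ℕ} {ψ : Form (Fin.elim0 : FCtx 0) σ}
      {φ : Form (Fin.elim0 : FCtx 0) τ} :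
      Pos k ψ → Neg k φ → Neg k (ψ.imp φ : Form Δ (TyExpr.arrow σ τ))
  | all {n : ℕ} {Δ : FCtx n} {τ : PureType} {k : ℕ} {φ : Form Δ τ} :
      Neg (k + 1) φ → Neg k φ.all
  | nu {n : ℕ} {Δ : FCtx n} {τ : PureType} {k : ℕ} {t : ITerm}
      {φ : Form (Fin.cons τ Δ : FCtx (n + 1)) τ} :
      Neg k φ → Neg k (φ.nu t)
  | mu {n : ℕ} {Δ : FCtx n} {τ : PureType} {k : ℕ} {t : ITerm}
      {φ : Form (Fin.cons τ Δ : FCtx (n + 1)) τ} :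
      Neg k φ → ¬ t.Occurs k → Neg k (φ.mu t)

end

end Form

/-- The polarities: neutral, positive, negative. -/
inductive Polarity : Type
  | neutral
  | pos
  | neg

/-- The opposite polarity. -/
def Polarity.opp : Polarity → Polarity
  | neutral => neutral
  | pos => neg
  | neg => pos

namespace Form

/-- `Lang s φ`: the formula `φ : Form Δ τ` belongs to the language `L^s(Δ; τ)`. The rule weakening
fixpoint contexts is absorbed in `var` and `imp`, which are available in all contexts. -/
inductive Lang : {n : ℕ} → {Δ : FCtx n} → {τ : PureType} → Polarity → Form Δ τ → Prop
  | tt {n : ℕ} {Δ : FCtx n} {τ : PureType} {s : Polarity} : Lang s (tt : Form Δ τ)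
  | ff {n : ℕ} {Δ : FCtx n} {τ : PureType} {s : Polarity} : Lang s (ff : Form Δ τ)
  | and {n : ℕ} {Δ : FCtx n} {τ : PureType} {s : Polarity} {φ ψ : Form Δ τ} :
      Lang s φ → Lang s ψ → Lang s (φ.and ψ)
  | or {n : ℕ} {Δ : FCtx n} {τ : PureType} {s : Polarity} {φ ψ : Form Δ τ} :
      Lang s φ → Lang s ψ → Lang s (φ.or ψ)
  | triv {n : ℕ} {Δ : FCtx n} {s : Polarity} : Lang s (triv : Form Δ TyExpr.unit)
  | fst {n : ℕ} {Δ : FCtx n} {σ τ : PureType} {s : Polarity} {φ : Form Δ σ} :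
      Lang s φ → Lang s (φ.fst : Form Δ (TyExpr.prod σ τ))
  | snd {n : ℕ} {Δ : FCtx n} {σ τ : PureType} {s : Polarity} {φ : Form Δ τ} :
      Lang s φ → Lang s (φ.snd : Form Δ (TyExpr.prod σ τ))
  | inl {n : ℕ} {Δ : FCtx n} {σ τ : PureType} {s : Polarity} {φ : Form Δ σ} :
      Lang s φ → Lang s (φ.inl : Form Δ (TyExpr.sum σ τ))
  | inr {n : ℕ} {Δ : FCtx n} {σ τ : PureType} {s : Polarity} {φ : Form Δ τ} :
      Lang s φ → Lang s (φ.inr : Form Δ (TyExpr.sum σ τ))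
  | fold {n : ℕ} {Δ : FCtx n} {τ : TyExpr 1} {s : Polarity} {φ : Form Δ τ.unroll} :
      Lang s φ → Lang s φ.fold
  | var {n : ℕ} {Δ : FCtx n} {τ : PureType} {s : Polarity} (i : Fin n) (h : Δ i = τ) :
      Lang s (var i h : Form Δ τ)
  | mu {n : ℕ} {Δ : FCtx n} {τ : PureType} {s : Polarity} (t : ITerm)
      {φ : Form (Fin.cons τ Δ : FCtx (n + 1)) τ} : Lang s φ → Lang s (φ.mu t)
  | nu {n : ℕ} {Δ : FCtx n} {τ : PureType} {s : Polarity} (t : ITerm)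
      {φ : Form (Fin.cons τ Δ : FCtx (n + 1)) τ} : Lang s φ → Lang s (φ.nu t)
  | ex {n : ℕ} {Δ : FCtx n} {τ : PureType} {φ : Form Δ τ} :
      Lang .pos φ → Pos 0 φ → Lang .pos φ.ex
  | all {n : ℕ} {Δ : FCtx n} {τ : PureType} {φ : Form Δ τ} :
      Lang .neg φ → Neg 0 φ → Lang .neg φ.all
  | imp {n : ℕ} {Δ : FCtx n} {σ τ : PureType} {s : Polarity}
      {ψ : Form (Fin.elim0 : FCtx 0) σ} {φ : Form (Fin.elim0 : FCtx 0) τ} :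
      Lang s.opp ψ → Lang s φ → Lang s (ψ.imp φ : Form Δ (TyExpr.arrow σ τ))

end Form

/-! ## Semantics of formulae -/

open PureType

/-- A valuation of a fixpoint context: sets for the fixpoint variables and natural numbers for
the iteration variables. -/
structure FVal {n : ℕ} (Δ : FCtx n) : Type where
  fp : ∀ i, Set (Dom (Δ i))
  it : ℕ → ℕ

namespace FVal

variable {n : ℕ} {Δ : FCtx n}

/-- `ρ[S / X]`. -/
def update (ρ : FVal Δ) (X : Fin n) (S : Set (Dom (Δ X))) : FVal Δ :=
  ⟨Function.update ρ.fp X S, ρ.it⟩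

/-- Extension of a valuation by a value for a newly bound fixpoint variable. -/
def push {τ : PureType} (ρ : FVal Δ) (S : Set (Dom τ)) :
    FVal (Fin.cons τ Δ : FCtx (n + 1)) :=
  ⟨Fin.cases S ρ.fp, ρ.it⟩

/-- Extension of a valuation by a value for a newly bound iteration variable. -/
def pushIt (ρ : FVal Δ) (m : ℕ) : FVal Δ :=
  ⟨ρ.fp, fun k => Nat.casesOn k m ρ.it⟩

/-- Restriction to the empty fixpoint context. -/
def closed (ρ : FVal Δ) : FVal (Fin.elim0 : FCtx 0) :=
  ⟨fun i => i.elim0, ρ.it⟩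

end FVal

namespace Form

/-- The interpretation of formulae (on all typed formulae, whatever their polarity). Bounded iteration iterates the function `S ↦ ⟦φ⟧ρ[S / X]`;
`eval_mu` and `eval_nu` below show that this is the interpretation of the iterated substitutions
`(X.φ)^m(False)` and `(X.φ)^m(True)`, where `m = ⟦t⟧ρ`. -/
noncomputable def eval : {n : ℕ} → {Δ : FCtx n} → {τ : PureType} → Form Δ τ → FVal Δ →
    Set (Dom τ)
  | _, _, _, tt, _ => Set.univ
  | _, _, _, ff, _ => ∅
  | _, _, _, and φ ψ, ρ => φ.eval ρ ∩ ψ.eval ρ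
  | _, _, _, or φ ψ, ρ => φ.eval ρ ∪ ψ.eval ρ
  | _, _, _, triv, _ => {top}
  | _, _, _, fst φ, ρ => {x | fstMap x ∈ φ.eval ρ}
  | _, _, _, snd φ, ρ => {x | sndMap x ∈ φ.eval ρ}
  | _, _, _, inl φ, ρ => inlMap '' φ.eval ρ
  | _, _, _, inr φ, ρ => inrMap '' φ.eval ρ
  | _, _, _, fold φ, ρ => {x | unfold x ∈ φ.eval ρ}
  | _, _, _, var i h, ρ => h ▸ ρ.fp i
  | _, _, _, mu t φ, ρ => (fun S => φ.eval (ρ.push S))^[t.eval ρ.it] ∅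
  | _, _, _, nu t φ, ρ => (fun S => φ.eval (ρ.push S))^[t.eval ρ.it] Set.univ
  | _, _, _, ex φ, ρ => ⋃ m : ℕ, φ.eval (ρ.pushIt m)
  | _, _, _, all φ, ρ => ⋂ m : ℕ, φ.eval (ρ.pushIt m)
  | _, _, _, imp ψ φ, ρ => {f | ∀ x ∈ ψ.eval ρ.closed, app f x ∈ φ.eval ρ.closed}

/-! ### Substitution of formulae, and the syntactic description of bounded iteration -/

/-- Renaming of fixpoint variables. -/
def ren : {n m : ℕ} → {Δ : FCtx n} → {Γ : FCtx m} → {τ : PureType} → (r : Fin n → Fin m) →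
    (∀ i, Γ (r i) = Δ i) → Form Δ τ → Form Γ τ
  | _, _, _, _, _, _, _, tt => tt
  | _, _, _, _, _, _, _, ff => ff
  | _, _, _, _, _, r, hr, and φ ψ => and (φ.ren r hr) (ψ.ren r hr)
  | _, _, _, _, _, r, hr, or φ ψ => or (φ.ren r hr) (ψ.ren r hr)
  | _, _, _, _, _, _, _, triv => triv
  | _, _, _, _, _, r, hr, fst φ => fst (φ.ren r hr)
  | _, _, _, _, _, r, hr, snd φ => snd (φ.ren r hr)
  | _, _, _, _, _, r, hr, inl φ => inl (φ.ren r hr)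
  | _, _, _, _, _, r, hr, inr φ => inr (φ.ren r hr)
  | _, _, _, _, _, r, hr, fold φ => fold (φ.ren r hr)
  | _, _, _, _, _, r, hr, var i h => var (r i) ((hr i).trans h)
  | _, _, _, _, _, r, hr, mu t φ =>
    mu t (φ.ren (Fin.cases 0 fun i => (r i).succ) (Fin.cases rfl hr))
  | _, _, _, _, _, r, hr, nu t φ =>
    nu t (φ.ren (Fin.cases 0 fun i => (r i).succ) (Fin.cases rfl hr))
  | _, _, _, _, _, r, hr, ex φ => ex (φ.ren r hr)
  | _, _, _, _, _, r, hr, all φ => all (φ.ren r hr)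
  | _, _, _, _, _, _, _, imp ψ φ => imp ψ φ

/-- Renaming of iteration variables. -/
def renIt : {n : ℕ} → {Δ : FCtx n} → {τ : PureType} → (ℕ → ℕ) → Form Δ τ → Form Δ τ
  | _, _, _, _, tt => tt
  | _, _, _, _, ff => ff
  | _, _, _, f, and φ ψ => and (φ.renIt f) (ψ.renIt f)
  | _, _, _, f, or φ ψ => or (φ.renIt f) (ψ.renIt f)
  | _, _, _, _, triv => triv
  | _, _, _, f, fst φ => fst (φ.renIt f)
  | _, _, _, f, snd φ => snd (φ.renIt f)
  | _, _, _, f, inl φ => inl (φ.renIt f)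
  | _, _, _, f, inr φ => inr (φ.renIt f)
  | _, _, _, f, fold φ => fold (φ.renIt f)
  | _, _, _, _, var i h => var i h
  | _, _, _, f, mu t φ => mu (t.ren f) (φ.renIt f)
  | _, _, _, f, nu t φ => nu (t.ren f) (φ.renIt f)
  | _, _, _, f, ex φ => ex (φ.renIt fun k => Nat.casesOn k 0 fun j => f j + 1)
  | _, _, _, f, all φ => all (φ.renIt fun k => Nat.casesOn k 0 fun j => f j + 1)
  | _, _, _, f, imp ψ φ => imp (ψ.renIt f) (φ.renIt f)

/-- Lifting of a substitution under a binder for a fixpoint variable. -/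
def lift {n m : ℕ} {Δ : FCtx n} {Γ : FCtx m} (τ : PureType) (s : ∀ i, Form Γ (Δ i)) :
    ∀ i, Form (Fin.cons τ Γ : FCtx (m + 1)) ((Fin.cons τ Δ : FCtx (n + 1)) i) :=
  Fin.cases (var 0 rfl) fun i => (s i).ren Fin.succ fun _ => rfl

/-- Simultaneous capture-avoiding substitution for the fixpoint variables. -/
def subst : {n m : ℕ} → {Δ : FCtx n} → {Γ : FCtx m} → {τ : PureType} →
    (∀ i, Form Γ (Δ i)) → Form Δ τ → Form Γ τ
  | _, _, _, _, _, _, tt => tt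
  | _, _, _, _, _, _, ff => ff
  | _, _, _, _, _, s, and φ ψ => and (φ.subst s) (ψ.subst s)
  | _, _, _, _, _, s, or φ ψ => or (φ.subst s) (ψ.subst s)
  | _, _, _, _, _, _, triv => triv
  | _, _, _, _, _, s, fst φ => fst (φ.subst s)
  | _, _, _, _, _, s, snd φ => snd (φ.subst s)
  | _, _, _, _, _, s, inl φ => inl (φ.subst s)
  | _, _, _, _, _, s, inr φ => inr (φ.subst s)
  | _, _, _, _, _, s, fold φ => fold (φ.subst s)
  | _, _, _, _, _, s, var i h => h ▸ s i
  | _, _, _, _, τ, s, mu t φ => mu t (φ.subst (lift τ s))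
  | _, _, _, _, τ, s, nu t φ => nu t (φ.subst (lift τ s))
  | _, _, _, _, _, s, ex φ => ex (φ.subst fun i => (s i).renIt Nat.succ)
  | _, _, _, _, _, s, all φ => all (φ.subst fun i => (s i).renIt Nat.succ)
  | _, _, _, _, _, _, imp ψ φ => imp ψ φ

/-- `φ[ψ / X]`, where `X` is the variable `0`. -/
def inst {n : ℕ} {Δ : FCtx n} {σ τ : PureType} (φ : Form (Fin.cons σ Δ : FCtx (n + 1)) τ)
    (ψ : Form Δ σ) : Form Δ τ :=
  φ.subst (Fin.cases ψ fun i => var i rfl)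

/-- The formula `(X.φ)^m(ψ)`. -/
def iter {n : ℕ} {Δ : FCtx n} {τ : PureType} (φ : Form (Fin.cons τ Δ : FCtx (n + 1)) τ)
    (ψ : Form Δ τ) : ℕ → Form Δ τ
  | 0 => ψ
  | m + 1 => φ.inst (φ.iter ψ m)

theorem eval_ren {n m : ℕ} {Δ : FCtx n} {Γ : FCtx m} {τ : PureType} (r : Fin n → Fin m)
    (hr : ∀ i, Γ (r i) = Δ i) (φ : Form Δ τ) (ρ : FVal Γ) :
    (φ.ren r hr).eval ρ = φ.eval ⟨fun i => hr i ▸ ρ.fp (r i), ρ.it⟩ := by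
  induction φ generalizing m with
  | tt => rfl
  | ff => rfl
  | and φ ψ h1 h2 => simp only [ren, eval, h1, h2]
  | or φ ψ h1 h2 => simp only [ren, eval, h1, h2]
  | triv => rfl
  | fst φ ih => simp only [ren, eval, ih]
  | snd φ ih => simp only [ren, eval, ih]
  | inl φ ih => simp only [ren, eval, ih]
  | inr φ ih => simp only [ren, eval, ih]
  | fold φ ih => simp only [ren, eval, ih]
  | var i h => subst h; simp only [ren, eval]
  | mu t φ ih =>
    simp only [ren, eval, ih]
    congr 1
    funext S
    congr 2
    funext i
    refine Fin.cases ?_ (fun i => ?_) i <;> rfl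
  | nu t φ ih =>
    simp only [ren, eval, ih]
    congr 1
    funext S
    congr 2
    funext i
    refine Fin.cases ?_ (fun i => ?_) i <;> rfl
  | ex φ ih => simp only [ren, eval, ih]; rfl
  | all φ ih => simp only [ren, eval, ih]; rfl
  | imp ψ φ h1 h2 => rfl

theorem eval_renIt {n : ℕ} {Δ : FCtx n} {τ : PureType} (f : ℕ → ℕ) (φ : Form Δ τ) (ρ : FVal Δ) :
    (φ.renIt f).eval ρ = φ.eval ⟨ρ.fp, ρ.it ∘ f⟩ := by
  induction φ generalizing f with
  | tt => rfl
  | ff => rfl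
  | and φ ψ h1 h2 => simp only [renIt, eval, h1, h2]
  | or φ ψ h1 h2 => simp only [renIt, eval, h1, h2]
  | triv => rfl
  | fst φ ih => simp only [renIt, eval, ih]
  | snd φ ih => simp only [renIt, eval, ih]
  | inl φ ih => simp only [renIt, eval, ih]
  | inr φ ih => simp only [renIt, eval, ih]
  | fold φ ih => simp only [renIt, eval, ih]
  | var i h => rfl
  | mu t φ ih => simp only [renIt, eval, ih, ITerm.eval_ren]; rfl
  | nu t φ ih => simp only [renIt, eval, ih, ITerm.eval_ren]; rfl
  | ex φ ih =>
    simp only [renIt, eval, ih]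
    refine Set.iUnion_congr fun m => congrArg φ.eval (congrArg (FVal.mk ρ.fp) ?_)
    funext k
    cases k <;> rfl
  | all φ ih =>
    simp only [renIt, eval, ih]
    refine Set.iInter_congr fun m => congrArg φ.eval (congrArg (FVal.mk ρ.fp) ?_)
    funext k
    cases k <;> rfl
  | imp ψ φ h1 h2 => simp only [renIt, eval, h1, h2]; rfl

theorem eval_subst {n m : ℕ} {Δ : FCtx n} {Γ : FCtx m} {τ : PureType}
    (s : ∀ i, Form Γ (Δ i)) (φ : Form Δ τ) (ρ : FVal Γ) :
    (φ.subst s).eval ρ = φ.eval ⟨fun i => (s i).eval ρ, ρ.it⟩ := by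
  induction φ generalizing m with
  | tt => rfl
  | ff => rfl
  | and φ ψ h1 h2 => simp only [subst, eval, h1, h2]
  | or φ ψ h1 h2 => simp only [subst, eval, h1, h2]
  | triv => rfl
  | fst φ ih => simp only [subst, eval, ih]
  | snd φ ih => simp only [subst, eval, ih]
  | inl φ ih => simp only [subst, eval, ih]
  | inr φ ih => simp only [subst, eval, ih]
  | fold φ ih => simp only [subst, eval, ih]
  | var i h => subst h; rfl
  | mu t φ ih =>
    simp only [subst, eval, ih]
    congr 1
    funext S
    congr 2
    funext i
    refine Fin.cases rfl (fun i => ?_) i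
    exact eval_ren _ _ _ _
  | nu t φ ih =>
    simp only [subst, eval, ih]
    congr 1
    funext S
    congr 2
    funext i
    refine Fin.cases rfl (fun i => ?_) i
    exact eval_ren _ _ _ _
  | ex φ ih => simp only [subst, eval, ih, eval_renIt]; rfl
  | all φ ih => simp only [subst, eval, ih, eval_renIt]; rfl
  | imp ψ φ h1 h2 => rfl

theorem eval_iter {n : ℕ} {Δ : FCtx n} {τ : PureType}
    (φ : Form (Fin.cons τ Δ : FCtx (n + 1)) τ) (ψ : Form Δ τ) (ρ : FVal Δ) (m : ℕ) :
    (φ.iter ψ m).eval ρ = (fun S => φ.eval (ρ.push S))^[m] (ψ.eval ρ) := by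
  induction m with
  | zero => rfl
  | succ m ih =>
    rw [Function.iterate_succ_apply', ← ih, iter, inst, eval_subst]
    congr 2
    funext i
    refine Fin.cases ?_ (fun i => ?_) i <;> rfl

/-- `⟦(μ^t X)φ⟧ρ = ⟦(X.φ)^(⟦t⟧ρ)(False)⟧ρ`. -/
theorem eval_mu {n : ℕ} {Δ : FCtx n} {τ : PureType} (t : ITerm)
    (φ : Form (Fin.cons τ Δ : FCtx (n + 1)) τ) (ρ : FVal Δ) :
    (φ.mu t).eval ρ = (φ.iter ff (t.eval ρ.it)).eval ρ := by
  simp only [eval_iter, eval]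

/-- `⟦(ν^t X)φ⟧ρ = ⟦(X.φ)^(⟦t⟧ρ)(True)⟧ρ`. -/
theorem eval_nu {n : ℕ} {Δ : FCtx n} {τ : PureType} (t : ITerm)
    (φ : Form (Fin.cons τ Δ : FCtx (n + 1)) τ) (ρ : FVal Δ) :
    (φ.nu t).eval ρ = (φ.iter tt (t.eval ρ.it)).eval ρ := by
  simp only [eval_iter, eval]

/-- The function `S ↦ ⟦φ⟧ρ[S / X]`. -/
noncomputable def evalFun {n : ℕ} {Δ : FCtx n} {τ : PureType} (φ : Form Δ τ) (ρ : FVal Δ)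
    (X : Fin n) : Set (Dom (Δ X)) → Set (Dom τ) :=
  fun S => φ.eval (ρ.update X S)

end Form

/-- Scott-cocontinuity: preservation of infima of (nonempty) codirected sets. For functions
between powersets, these are the codirected intersections. -/
def ScottCocontinuous {α β : Type} [Preorder α] [Preorder β] (f : α → β) : Prop :=
  ∀ ⦃d : Set α⦄, d.Nonempty → DirectedOn (· ≥ ·) d → ∀ ⦃a⦄, IsGLB d a → IsGLB (f '' d) (f a)

/-
For fixed values of the iteration variables, the interpretation of a formula is a function of all
fixpoint variables jointly, and every connective acts on it by an operation that preserves directed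
unions: images, preimages and unions are left adjoints, binary intersections do so by frame
distributivity together with directedness, bounded iteration is a composition, and an implication
is constant in the fixpoint variables. The only exception is `∀ k`, an infinite intersection.
Reversing the order gives cocontinuity, with `∃ k` as the only exception; here images need a
separate argument, as they preserve nonempty intersections only because the inclusions into a sum
are injective.
-/

lemma monotone_iterate {α β : Type*} [Preorder α] [Preorder β] {F : β → α → β}
    (hF : Monotone (Function.uncurry F)) {b : β} {m : ℕ} : Monotone fun a => (F · a)^[m] b := by
  intro a a' ha
  have hmono : Monotone (F · a) := fun _ _ hy => hF (Prod.mk_le_mk.2 ⟨hy, le_rfl⟩)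
  exact hmono.iterate_le_of_le (fun _ => hF (Prod.mk_le_mk.2 ⟨le_rfl, ha⟩)) m b

section ScottContinuous

variable {α β : Type*}

lemma scottContinuous_of_galoisConnection [Preorder α] [Preorder β] {l : α → β} {u : β → α}
    (gc : GaloisConnection l u) : ScottContinuous l :=
  fun _ _ _ _ h => gc.isLUB_l_image h

lemma scottContinuous_image (f : α → β) : ScottContinuous (Set.image f) :=
  scottContinuous_of_galoisConnection Set.image_preimage

lemma scottContinuous_preimage (f : α → β) : ScottContinuous (Set.preimage f) :=
  scottContinuous_of_galoisConnection Set.preimage_kernImage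

lemma scottContinuous_inf [Order.Frame α] : ScottContinuous fun p : α × α => p.1 ⊓ p.2 :=
  .fromProd (fun _ => scottContinuous_of_galoisConnection gc_inf_himp)
    fun b => by
      simpa only [inf_comm] using scottContinuous_of_galoisConnection (gc_inf_himp (a := b))

lemma scottContinuous_pi {ι : Type*} {π : ι → Type*} [Preorder α] [∀ i, Preorder (π i)]
    {f : α → ∀ i, π i} (hf : ∀ i, ScottContinuous fun x => f x i) : ScottContinuous f := by
  intro d hne hdir a ha
  refine isLUB_pi.2 fun i => ?_
  rw [Set.image_image]
  exact hf i hne hdir ha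

lemma scottContinuous_iSup [Preorder α] [CompleteLattice β] {ι : Type*} {f : ι → α → β}
    (hf : ∀ i, ScottContinuous (f i)) : ScottContinuous fun x => ⨆ i, f i x :=
  .comp (f := fun x i => f i x) (g := iSup) (scottContinuous_pi hf)
    (scottContinuous_of_galoisConnection (u := Function.const ι) fun _ _ => iSup_le_iff)

lemma scottContinuous_eval {ι : Type*} {π : ι → Type*} [∀ i, Preorder (π i)] (i : ι) :
    ScottContinuous (Function.eval i : (∀ i, π i) → π i) :=
  fun _ _ _ _ h => isLUB_pi.1 h i

lemma scottContinuous_update {ι : Type*} [DecidableEq ι] {π : ι → Type*} [∀ i, Preorder (π i)]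
    (f : ∀ i, π i) (i : ι) : ScottContinuous (Function.update f i) := by
  refine scottContinuous_pi fun j => ?_
  obtain rfl | hj := eq_or_ne j i
  · simp only [Function.update_self]
    exact .id
  · simp only [Function.update_of_ne hj]
    exact .const (f j)

lemma scottContinuous_finCons {n : ℕ} {π : Fin (n + 1) → Type*} [∀ i, Preorder (π i)] :
    ScottContinuous fun p : π 0 × (∀ i : Fin n, π i.succ) => (Fin.cons p.1 p.2 : ∀ i, π i) :=
  scottContinuous_pi <| Fin.cases .fst fun i =>
    ScottContinuous.comp (g := Function.eval i) .snd (scottContinuous_eval i)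

lemma scottContinuous_iterate [Preorder α] [Preorder β] {F : β → α → β}
    (hF : ScottContinuous (Function.uncurry F)) {b : β} {m : ℕ} :
    ScottContinuous fun a => (F · a)^[m] b := by
  induction m with
  | zero => exact .const b
  | succ m ih =>
    simp only [Function.iterate_succ_apply']
    exact (ih.prodMk .id).comp hF

end ScottContinuous

section ScottCocontinuous

variable {α β γ : Type}

-- `ScottCocontinuous f` unfolds to `ScottContinuous f` between the order duals, so the lemmas above
-- apply to it directly.

namespace ScottCocontinuous

lemma const [Preorder α] [Preorder β] (b : β) : ScottCocontinuous (Function.const α b) :=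
  ScottContinuous.const (α := αᵒᵈ) (β := βᵒᵈ) b

lemma comp [Preorder α] [Preorder β] [Preorder γ] {f : α → β} {g : β → γ}
    (hf : ScottCocontinuous f) (hg : ScottCocontinuous g) : ScottCocontinuous (g ∘ f) :=
  ScottContinuous.comp (α := αᵒᵈ) (β := βᵒᵈ) (γ := γᵒᵈ) hf hg

lemma prodMk [Preorder α] [Preorder β] [Preorder γ] {f : α → β} {g : α → γ}
    (hf : ScottCocontinuous f) (hg : ScottCocontinuous g) :
    ScottCocontinuous fun x => (f x, g x) :=
  ScottContinuous.prodMk (α := αᵒᵈ) (β := βᵒᵈ) (γ := γᵒᵈ) hf hg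

end ScottCocontinuous

lemma scottCocontinuous_of_galoisConnection [Preorder α] [Preorder β] {l : α → β} {u : β → α}
    (gc : GaloisConnection l u) : ScottCocontinuous u :=
  scottContinuous_of_galoisConnection gc.dual

lemma scottCocontinuous_preimage (f : α → β) : ScottCocontinuous (Set.preimage f) :=
  scottCocontinuous_of_galoisConnection Set.image_preimage

lemma scottCocontinuous_image {f : α → β} (hf : Function.Injective f) :
    ScottCocontinuous (Set.image f) := by
  intro d hne _ a ha
  rw [ha.unique (isGLB_sInf d), Set.sInf_eq_sInter, Set.sInter_eq_biInter,
    hf.injOn.image_biInter_eq hne, ← Set.sInter_image]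
  exact isGLB_sInf _

lemma scottCocontinuous_sup [Order.Coframe α] : ScottCocontinuous fun p : α × α => p.1 ⊔ p.2 :=
  scottContinuous_inf (α := αᵒᵈ)

lemma scottCocontinuous_inf [SemilatticeInf α] : ScottCocontinuous fun p : α × α => p.1 ⊓ p.2 :=
  ScottContinuous.sup₂ (β := αᵒᵈ)

lemma scottCocontinuous_iInf [Preorder α] [CompleteLattice β] {ι : Type*} {f : ι → α → β}
    (hf : ∀ i, ScottCocontinuous (f i)) : ScottCocontinuous fun x => ⨅ i, f i x :=
  scottContinuous_iSup (α := αᵒᵈ) (β := βᵒᵈ) hf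

lemma scottCocontinuous_eval {ι : Type} {π : ι → Type} [∀ i, Preorder (π i)] (i : ι) :
    ScottCocontinuous (Function.eval i : (∀ i, π i) → π i) :=
  scottContinuous_eval (π := fun i => (π i)ᵒᵈ) i

lemma scottCocontinuous_update {ι : Type} [DecidableEq ι] {π : ι → Type} [∀ i, Preorder (π i)]
    (f : ∀ i, π i) (i : ι) : ScottCocontinuous (Function.update f i) :=
  scottContinuous_update (π := fun i => (π i)ᵒᵈ) f i

lemma scottCocontinuous_finCons {n : ℕ} {π : Fin (n + 1) → Type} [∀ i, Preorder (π i)] :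
    ScottCocontinuous fun p : π 0 × (∀ i : Fin n, π i.succ) => (Fin.cons p.1 p.2 : ∀ i, π i) :=
  scottContinuous_finCons (π := fun i => (π i)ᵒᵈ)

lemma scottCocontinuous_iterate [Preorder α] [Preorder β] {F : β → α → β}
    (hF : ScottCocontinuous (Function.uncurry F)) {b : β} {m : ℕ} :
    ScottCocontinuous fun a => (F · a)^[m] b :=
  scottContinuous_iterate (α := αᵒᵈ) (β := βᵒᵈ) hF

end ScottCocontinuous

lemma inlMap_injective {σ τ : PureType} :
    Function.Injective (inlMap : Dom σ → Dom (TyExpr.sum σ τ)) :=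
  fun _ _ h => Sum.inl_injective (WithBot.coe_injective h)

lemma inrMap_injective {σ τ : PureType} :
    Function.Injective (inrMap : Dom τ → Dom (TyExpr.sum σ τ)) :=
  fun _ _ h => Sum.inr_injective (WithBot.coe_injective h)

namespace Form

/-- The quantifier `∀ k` occurs only inside implications. This is all that continuity requires of
a formula; implications are exempt because they contain no free fixpoint variables. -/
def AllFree : {n : ℕ} → {Δ : FCtx n} → {τ : PureType} → Form Δ τ → Prop
  | _, _, _, tt | _, _, _, ff | _, _, _, triv | _, _, _, var _ _ | _, _, _, imp _ _ => True
  | _, _, _, and φ ψ | _, _, _, or φ ψ => φ.AllFree ∧ ψ.AllFree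
  | _, _, _, fst φ | _, _, _, snd φ | _, _, _, inl φ | _, _, _, inr φ | _, _, _, fold φ
  | _, _, _, mu _ φ | _, _, _, nu _ φ | _, _, _, ex φ => φ.AllFree
  | _, _, _, all _ => False

/-- The quantifier `∃ k` occurs only inside implications. This is all that cocontinuity requires of
a formula; implications are exempt because they contain no free fixpoint variables. -/
def ExFree : {n : ℕ} → {Δ : FCtx n} → {τ : PureType} → Form Δ τ → Prop
  | _, _, _, tt | _, _, _, ff | _, _, _, triv | _, _, _, var _ _ | _, _, _, imp _ _ => True
  | _, _, _, and φ ψ | _, _, _, or φ ψ => φ.ExFree ∧ ψ.ExFree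
  | _, _, _, fst φ | _, _, _, snd φ | _, _, _, inl φ | _, _, _, inr φ | _, _, _, fold φ
  | _, _, _, mu _ φ | _, _, _, nu _ φ | _, _, _, all φ => φ.ExFree
  | _, _, _, ex _ => False

variable {n : ℕ} {Δ : FCtx n} {τ : PureType}

lemma Lang.allFree {φ : Form Δ τ} (h : Lang .pos φ) : φ.AllFree := by
  generalize hs : Polarity.pos = s at h
  induction h with
  | tt | ff | triv | var | imp => trivial
  | and _ _ ihφ ihψ | or _ _ ihφ ihψ => exact ⟨ihφ hs, ihψ hs⟩
  | fst _ ih | snd _ ih | inl _ ih | inr _ ih | fold _ ih | mu _ _ ih | nu _ _ ih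
  | ex _ _ ih => exact ih hs
  | all => cases hs

lemma Lang.exFree {φ : Form Δ τ} (h : Lang .neg φ) : φ.ExFree := by
  generalize hs : Polarity.neg = s at h
  induction h with
  | tt | ff | triv | var | imp => trivial
  | and _ _ ihφ ihψ | or _ _ ihφ ihψ => exact ⟨ihφ hs, ihψ hs⟩
  | fst _ ih | snd _ ih | inl _ ih | inr _ ih | fold _ ih | mu _ _ ih | nu _ _ ih
  | all _ _ ih => exact ih hs
  | ex => cases hs

/-- The interpretation of a formula as a function of all fixpoint variables at once, for fixed
values of the iteration variables. -/
noncomputable def evalFp (φ : Form Δ τ) (δ : ℕ → ℕ) (S : ∀ i, Set (Dom (Δ i))) : Set (Dom τ) :=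
  φ.eval ⟨S, δ⟩

lemma evalFp_mu (t : ITerm) (φ : Form (Fin.cons τ Δ : FCtx (n + 1)) τ) (δ : ℕ → ℕ) :
    (φ.mu t).evalFp δ = fun S => (fun T => φ.evalFp δ (Fin.cons T S))^[t.eval δ] ∅ :=
  rfl

lemma evalFp_nu (t : ITerm) (φ : Form (Fin.cons τ Δ : FCtx (n + 1)) τ) (δ : ℕ → ℕ) :
    (φ.nu t).evalFp δ = fun S => (fun T => φ.evalFp δ (Fin.cons T S))^[t.eval δ] Set.univ :=
  rfl

lemma evalFp_ex (φ : Form Δ τ) (δ : ℕ → ℕ) :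
    φ.ex.evalFp δ = fun S => ⋃ m : ℕ, φ.evalFp (fun k => Nat.casesOn k m δ) S :=
  rfl

lemma evalFp_all (φ : Form Δ τ) (δ : ℕ → ℕ) :
    φ.all.evalFp δ = fun S => ⋂ m : ℕ, φ.evalFp (fun k => Nat.casesOn k m δ) S :=
  rfl

lemma evalFp_imp {σ : PureType} (ψ : Form (Fin.elim0 : FCtx 0) σ)
    (φ : Form (Fin.elim0 : FCtx 0) τ) (δ : ℕ → ℕ) :
    (ψ.imp φ : Form Δ (TyExpr.arrow σ τ)).evalFp δ = Function.const _
      {f | ∀ x ∈ ψ.evalFp δ (fun i => i.elim0), app f x ∈ φ.evalFp δ (fun i => i.elim0)} :=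
  rfl

lemma evalFp_monotone (φ : Form Δ τ) (δ : ℕ → ℕ) : Monotone (φ.evalFp δ) := by
  induction φ generalizing δ with
  | tt | ff | triv => exact monotone_const
  | imp ψ φ =>
    rw [evalFp_imp]
    exact monotone_const
  | and φ ψ ihφ ihψ => exact (ihφ δ).inf (ihψ δ)
  | or φ ψ ihφ ihψ => exact (ihφ δ).sup (ihψ δ)
  | fst φ ih | snd φ ih | fold φ ih => exact Set.monotone_preimage.comp (ih δ)
  | inl φ ih | inr φ ih => exact Set.monotone_image.comp (ih δ)
  | var i h =>
    subst h
    exact Function.monotone_eval i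
  | mu t φ ih =>
    rw [evalFp_mu]
    refine monotone_iterate ?_
    exact fun _ _ h => ih δ (Fin.cons_le_cons.2 h)
  | nu t φ ih =>
    rw [evalFp_nu]
    refine monotone_iterate ?_
    exact fun _ _ h => ih δ (Fin.cons_le_cons.2 h)
  | ex φ ih =>
    rw [evalFp_ex]
    exact fun _ _ h => Set.iUnion_mono fun m => ih _ h
  | all φ ih =>
    rw [evalFp_all]
    exact fun _ _ h => Set.iInter_mono fun m => ih _ h

lemma AllFree.scottContinuous_evalFp {φ : Form Δ τ} (hφ : φ.AllFree) (δ : ℕ → ℕ) :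
    ScottContinuous (φ.evalFp δ) := by
  induction φ generalizing δ with
  | tt | ff | triv => exact .const _
  | imp ψ φ =>
    rw [evalFp_imp]
    exact .const _
  | and φ ψ ihφ ihψ => exact ((ihφ hφ.1 δ).prodMk (ihψ hφ.2 δ)).comp scottContinuous_inf
  | or φ ψ ihφ ihψ => exact ((ihφ hφ.1 δ).prodMk (ihψ hφ.2 δ)).comp .sup₂
  | fst φ ih | snd φ ih | fold φ ih => exact (ih hφ δ).comp (scottContinuous_preimage _)
  | inl φ ih | inr φ ih => exact (ih hφ δ).comp (scottContinuous_image _)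
  | var i h =>
    subst h
    exact scottContinuous_eval i
  | mu t φ ih =>
    rw [evalFp_mu]
    refine scottContinuous_iterate ?_
    exact scottContinuous_finCons.comp (ih hφ δ)
  | nu t φ ih =>
    rw [evalFp_nu]
    refine scottContinuous_iterate ?_
    exact scottContinuous_finCons.comp (ih hφ δ)
  | ex φ ih =>
    rw [evalFp_ex]
    exact scottContinuous_iSup fun m => ih hφ _
  | all => exact hφ.elim

lemma ExFree.scottCocontinuous_evalFp {φ : Form Δ τ} (hφ : φ.ExFree) (δ : ℕ → ℕ) :
    ScottCocontinuous (φ.evalFp δ) := by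
  induction φ generalizing δ with
  | tt | ff | triv => exact .const _
  | imp ψ φ =>
    rw [evalFp_imp]
    exact .const _
  | and φ ψ ihφ ihψ => exact ((ihφ hφ.1 δ).prodMk (ihψ hφ.2 δ)).comp scottCocontinuous_inf
  | or φ ψ ihφ ihψ => exact ((ihφ hφ.1 δ).prodMk (ihψ hφ.2 δ)).comp scottCocontinuous_sup
  | fst φ ih | snd φ ih | fold φ ih => exact (ih hφ δ).comp (scottCocontinuous_preimage _)
  | inl φ ih => exact (ih hφ δ).comp (scottCocontinuous_image inlMap_injective)
  | inr φ ih => exact (ih hφ δ).comp (scottCocontinuous_image inrMap_injective)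
  | var i h =>
    subst h
    exact scottCocontinuous_eval i
  | mu t φ ih =>
    rw [evalFp_mu]
    refine scottCocontinuous_iterate ?_
    exact scottCocontinuous_finCons.comp (ih hφ δ)
  | nu t φ ih =>
    rw [evalFp_nu]
    refine scottCocontinuous_iterate ?_
    exact scottCocontinuous_finCons.comp (ih hφ δ)
  | all φ ih =>
    rw [evalFp_all]
    exact scottCocontinuous_iInf fun m => ih hφ _
  | ex => exact hφ.elim

lemma evalFun_eq_evalFp_comp_update (φ : Form Δ τ) (ρ : FVal Δ) (X : Fin n) :
    φ.evalFun ρ X = φ.evalFp ρ.it ∘ Function.update ρ.fp X :=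
  rfl

end Form

theorem mainTheorem9_general {n : ℕ} {Δ : FCtx n} {τ : PureType} (φ : Form Δ τ) (δ : ℕ → ℕ) :
    Monotone (φ.evalFp δ) ∧
    (φ.AllFree → ScottContinuous (φ.evalFp δ)) ∧
    (φ.ExFree → ScottCocontinuous (φ.evalFp δ)) :=
  ⟨φ.evalFp_monotone δ, fun h => h.scottContinuous_evalFp δ,
    fun h => h.scottCocontinuous_evalFp δ⟩

theorem mainTheorem9 {n : ℕ} (Δ : FCtx n) (τ : PureType) (φ : Form Δ τ) (ρ : FVal Δ) (X : Fin n) :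
    (∀ s : Polarity, Form.Lang s φ → Monotone (φ.evalFun ρ X)) ∧
    (Form.Lang .pos φ → ScottContinuous (φ.evalFun ρ X)) ∧
    (Form.Lang .neg φ → ScottCocontinuous (φ.evalFun ρ X)) := by
  obtain ⟨hmono, hcont, hcocont⟩ := mainTheorem9_general φ ρ.it
  rw [Form.evalFun_eq_evalFp_comp_update]
  exact ⟨fun _ _ => hmono.comp (Function.update_mono ..),
    fun h => (scottContinuous_update ρ.fp X).comp (hcont h.allFree),
    fun h => (scottCocontinuous_update ρ.fp X).comp (hcocont h.exFree)⟩
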